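/- Let $X$, $U$, $Y$ be complex Banach spaces, $\mathbb{R}_+=[0,\infty)$ and $1\le p<\infty$. A family $\mathcal{U}=\{U(t,\tau)\}_{t\ge\tau\ge0}\subset\mathcal{L}(X)$ is an evolution family if $U(t,t)=I$, $U(t,\tau)=U(t,s)U(s,\tau)$ for $t\ge s\ge\tau\ge0$, and $(t,\tau)\mapsto U(t,\tau)x$ is continuous on $\{t\ge\tau\ge0\}$ for each $x\in X$; it is exponentially stable if $\|U(t,\tau)\|\le Me^{\omega(t-\tau)}$ for all $t\ge\tau\ge 0$ with some $M\ge1$, $\omega<0$. For Banach spaces $E,F$ let $L^\infty(\mathbb{R}_+,\mathcal{L}_s(E,F))$ be the set of functions $D(\cdot):\mathbb{R}_+\to\mathcal{L}(E,F)$ such that $D(\cdot)x$ is strongly measurable for every $x\in E$ and $\|D(\cdot)\|_\infty:=\operatorname{ess\,sup}_{t\ge0}\|D(t)\|<\infty$. Let $\mathcal{U}$ be an exponentially stable evolution family on $X$, and let $\Gamma$ be the generator of the evolution semigroup $\{E^t\}_{t\ge0}$ on $L^p(\mathbb{R}_+,X)$ given by $(E^tf)(\tau)=U(\tau,\tau-t)f(\tau-t)$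 for $0\le t\le\tau$ and $(E^tf)(\tau)=0$ for $0\le\tau<t$. Let $B(\cdot)\in L^\infty(\mathbb{R}_+,\mathcal{L}_s(U,X))$ and $C(\cdot)\in L^\infty(\mathbb{R}_+,\mathcal{L}_s(X,Y))$, let $\mathcal{B}:L^p(\mathbb{R}_+,U)\to L^p(\mathbb{R}_+,X)$ and $\mathcal{C}:L^p(\mathbb{R}_+,X)\to L^p(\mathbb{R}_+,Y)$ be the corresponding multiplication operators, and set $$(\mathbb{G}f)(t)=\int_0^tU(t,\tau)f(\tau)\,d\tau,\qquad(\mathbb{L}u)(t)=C(t)\int_0^tU(t,\tau)B(\tau)u(\tau)\,d\tau .$$ For $\Delta(\cdot)\in L^\infty(\mathbb{R}_+,\mathcal{L}_s(Y,U))$ let $\mathcal{U}_\Delta=\{U_\Delta(t,s)\}_{t\ge s\ge 0}$ be the evolution family satisfying $$U_\Delta(t,s)x=U(t,s)x+\int_s^tU(t,\tau)B(\tau)\Delta(\tau)C(\tau)U_\Delta(\tau,s)x\,d\tau,\qquad x\in X,\ t\ge s\ge0,$$ and define the stability radius $$r_{stab}(\mathcal{U},B,C)=\sup\{r\ge0:\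 \|\Delta(\cdot)\|_\infty\le r\Rightarrow\mathcal{U}_\Delta\text{ is exponentially stable}\}\in[0,\infty].$$ Then $\Gamma$ has a bounded inverse on $L^p(\mathbb{R}_+,X)$, the integrals defining $\mathbb{G}f$ and $\mathbb{L}u$ converge for all $f\in L^p(\mathbb{R}_+,X)$, $u\in L^p(\mathbb{R}_+,U)$ and $t\ge 0$, the operator $\mathbb{G}$ is bounded on $L^p(\mathbb{R}_+,X)$, the operator $\mathbb{L}$ is bounded from $L^p(\mathbb{R}_+,U)$ to $L^p(\mathbb{R}_+,Y)$, and $$\mathbb{L}=\mathcal{C}\mathbb{G}\mathcal{B}=-\mathcal{C}\Gamma^{-1}\mathcal{B},\qquad\frac{1}{\|\mathbb{L}\|}\le r_{stab}(\mathcal{U},B,C).$$ In the unstructured case, where $U=Y=X$ and $B=C=I$, one has $$\mathbb{L}=-\Gamma^{-1}\quad\text{and}\quad\frac1{\|\Gamma^{-1}\|}\le r_{stab}(\mathcal{U},I,I)\le\frac{1}{r(\Gamma^{-1})},$$ where $r(\cdot)$ denotes the spectral radius (and $1/0=\infty$). -/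

import Mathlib

open MeasureTheory Set Filter Topology
open scoped NNReal ENNReal

/-- Lebesgue measure on the half-line `[0, ∞)`. -/
noncomputable abbrev halfLine : Measure ℝ := volume.restrict (Ici (0 : ℝ))

/-- A strongly (a.e.) measurable operator function applied to a strongly (a.e.) measurable
function is again strongly (a.e.) measurable. -/
theorem aestronglyMeasurable_strong_apply
    {E F : Type*} [NormedAddCommGroup E] [NormedSpace ℂ E]
    [NormedAddCommGroup F] [NormedSpace ℂ F] {μ : Measure ℝ}
    {T : ℝ → E →L[ℂ] F} (hT : ∀ x, AEStronglyMeasurable (fun t => T t x) μ)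
    {f : ℝ → E} (hf : AEStronglyMeasurable f μ) :
    AEStronglyMeasurable (fun t => T t (f t)) μ := by
  have simple : ∀ g : SimpleFunc ℝ E, AEStronglyMeasurable (fun t => T t (g t)) μ := by
    intro g
    have h : (fun t => T t (g t)) =
        fun t => ∑ x ∈ g.range, (g ⁻¹' {x}).indicator (fun t => T t x) t := by
      funext t
      rw [Finset.sum_eq_single (g t)]
      · simp
      · intro x _ hx
        exact indicator_of_notMem (fun h => hx (by simpa using h.symm)) _
      · intro h
        exact absurd (g.mem_range_self t) h
    rw [h]
    exact Finset.aestronglyMeasurable_fun_sum _ fun x _ =>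
      (hT x).indicator (g.measurableSet_fiber x)
  have hm : StronglyMeasurable (hf.mk f) := hf.stronglyMeasurable_mk
  have lim : AEStronglyMeasurable (fun t => T t (hf.mk f t)) μ := by
    refine aestronglyMeasurable_of_tendsto_ae atTop (fun n => simple (hm.approx n)) ?_
    exact Eventually.of_forall fun t =>
      ((T t).continuous.tendsto _).comp (hm.tendsto_approx t)
  refine lim.congr ?_
  filter_upwards [hf.ae_eq_mk] with t ht
  rw [ht]

/-! ### The space `L^∞(ℝ₊, 𝓛_s(E, F))` and its multiplication operators -/

/-- Strongly measurable, essentially bounded operator-valued functions on `[0, ∞)`. -/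
structure StrongLinfty (E F : Type*) [NormedAddCommGroup E] [NormedSpace ℂ E]
    [NormedAddCommGroup F] [NormedSpace ℂ F] where
  /-- The operator `D(t)`; only the values at `t ≥ 0` matter. -/
  op : ℝ → E →L[ℂ] F
  strongly_meas : ∀ x, AEStronglyMeasurable (fun t => op t x) halfLine
  ess_bdd : essSup (fun t => ‖op t‖ₑ) halfLine < ∞

namespace StrongLinfty

variable {E F : Type*} [NormedAddCommGroup E] [NormedSpace ℂ E]
  [NormedAddCommGroup F] [NormedSpace ℂ F]

/-- `‖D(·)‖_∞ = ess sup_{t ≥ 0} ‖D(t)‖`. -/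
noncomputable def essNorm (D : StrongLinfty E F) : ℝ≥0∞ := essSup (fun t => ‖D.op t‖ₑ) halfLine

theorem ae_norm_le (D : StrongLinfty E F) (f : ℝ → E) :
    ∀ᵐ t ∂halfLine, ‖D.op t (f t)‖ ≤ D.essNorm.toReal * ‖f t‖ := by
  have h : ∀ᵐ t ∂halfLine, ‖D.op t‖ₑ ≤ D.essNorm :=
    ae_le_essSup (f := fun t => ‖D.op t‖ₑ) (μ := halfLine)
  filter_upwards [h] with t ht
  refine (D.op t).le_of_opNorm_le ?_ _
  have := ENNReal.toReal_mono (show D.essNorm ≠ ∞ from D.ess_bdd.ne) ht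
  rwa [toReal_enorm] at this

theorem memLp (D : StrongLinfty E F) {p : ℝ≥0∞} (f : Lp E p halfLine) :
    MemLp (fun t => D.op t (f t)) p halfLine :=
  (Lp.memLp f).of_le_mul
    (aestronglyMeasurable_strong_apply D.strongly_meas (Lp.aestronglyMeasurable f))
    (D.ae_norm_le f)

/-- The multiplication operator `(𝓓 f)(t) = D(t) f(t)` on `L^p(ℝ₊)`. -/
noncomputable def mulOp (D : StrongLinfty E F) (p : ℝ≥0∞) [Fact (1 ≤ p)] :
    Lp E p halfLine →L[ℂ] Lp F p halfLine :=
  LinearMap.mkContinuous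
    { toFun := fun f => (D.memLp f).toLp _
      map_add' := fun f g => by
        rw [← MemLp.toLp_add, MemLp.toLp_eq_toLp_iff]
        filter_upwards [Lp.coeFn_add f g] with t ht
        simp only [Pi.add_apply, ht, map_add]
      map_smul' := fun c f => by
        rw [RingHom.id_apply, ← MemLp.toLp_const_smul, MemLp.toLp_eq_toLp_iff]
        filter_upwards [Lp.coeFn_smul c f] with t ht
        simp only [Pi.smul_apply, ht, map_smul] }
    D.essNorm.toReal
    (fun f => by
      refine Lp.norm_le_mul_norm_of_ae_le_mul ?_
      filter_upwards [D.ae_norm_le f, (D.memLp f).coeFn_toLp] with t ht h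
      simpa [h] using ht)

/-- The constant function `t ↦ I`. -/
noncomputable def one (E : Type*) [NormedAddCommGroup E] [NormedSpace ℂ E] :
    StrongLinfty E E where
  op := fun _ => ContinuousLinearMap.id ℂ E
  strongly_meas := fun _ => aestronglyMeasurable_const
  ess_bdd := lt_of_le_of_lt (essSup_le_of_ae_le ‖ContinuousLinearMap.id ℂ E‖ₑ
    (Eventually.of_forall fun _ => le_rfl)) enorm_lt_top

end StrongLinfty

/-! ### Generators and bounded inverses -/

/-- The (infinitesimal) generator of a one-parameter family `T(t)`, `t ≥ 0`, of bounded operators: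
`Dom A = {x | lim_{t → 0+} t⁻¹ (T(t) x - x) exists}` and `A x` is that limit. -/
noncomputable def semigroupGenerator {E : Type*} [NormedAddCommGroup E] [NormedSpace ℂ E]
    (T : ℝ → E →L[ℂ] E) : E →ₗ.[ℂ] E where
  domain :=
    { carrier := {x | ∃ y, Tendsto (fun t : ℝ => t⁻¹ • (T t x - x)) (𝓝[>] 0) (𝓝 y)}
      zero_mem' := ⟨0, by simp⟩
      add_mem' := by
        rintro a b ⟨y, hy⟩ ⟨z, hz⟩
        refine ⟨y + z, (hy.add hz).congr fun t => ?_⟩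
        rw [map_add, ← smul_add]
        congr 1
        abel
      smul_mem' := by
        rintro c a ⟨y, hy⟩
        refine ⟨c • y, (hy.const_smul c).congr fun t => ?_⟩
        rw [map_smul, ← smul_sub, smul_comm] }
  toFun :=
    { toFun := fun x => Classical.choose x.2
      map_add' := fun a b => by
        refine tendsto_nhds_unique (Classical.choose_spec (a + b).2)
          (((Classical.choose_spec a.2).add (Classical.choose_spec b.2)).congr fun t => ?_)
        rw [Submodule.coe_add, map_add, ← smul_add]
        congr 1
        abel
      map_smul' := fun c a => by
        refine tendsto_nhds_unique (Classical.choose_spec (c • a).2)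
          (((Classical.choose_spec a.2).const_smul c).congr fun t => ?_)
        rw [Submodule.coe_smul, map_smul, ← smul_sub, smul_comm] }

/-- `R` is the bounded inverse of the (possibly unbounded) operator `A`: `R A = I` on `Dom A`,
`R` maps into `Dom A`, and `A R = I`. -/
def IsBoundedInverse {E : Type*} [NormedAddCommGroup E] [NormedSpace ℂ E]
    (A : E →ₗ.[ℂ] E) (R : E →L[ℂ] E) : Prop :=
  (∀ x : A.domain, R (A x) = x) ∧ ∀ y : E, ∃ h : R y ∈ A.domain, A ⟨R y, h⟩ = y

/-! ### Evolution families -/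

/-- A (strongly continuous) evolution family `{U(t, τ)}_{t ≥ τ ≥ 0}`. The values of `U` outside
`t ≥ τ ≥ 0` are irrelevant. -/
structure EvolutionFamily (X : Type*) [NormedAddCommGroup X] [NormedSpace ℂ X] where
  U : ℝ → ℝ → X →L[ℂ] X
  comp : ∀ τ s t, 0 ≤ τ → τ ≤ s → s ≤ t → U t τ = U t s ∘L U s τ
  self : ∀ t, 0 ≤ t → U t t = ContinuousLinearMap.id ℂ X
  strong_cont : ∀ x, ContinuousOn (fun q : ℝ × ℝ => U q.1 q.2 x) {q | 0 ≤ q.2 ∧ q.2 ≤ q.1}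

namespace EvolutionFamily

variable {X : Type*} [NormedAddCommGroup X] [NormedSpace ℂ X]

def ExpBounded (𝒰 : EvolutionFamily X) : Prop :=
  ∃ M ω : ℝ, 1 ≤ M ∧ ∀ τ t, 0 ≤ τ → τ ≤ t → ‖𝒰.U t τ‖ ≤ M * Real.exp (ω * (t - τ))

/-- (Uniform) exponential stability: exponential boundedness with a negative exponent. -/
def ExpStable (𝒰 : EvolutionFamily X) : Prop :=
  ∃ M ω : ℝ, 1 ≤ M ∧ ω < 0 ∧ ∀ τ t, 0 ≤ τ → τ ≤ t → ‖𝒰.U t τ‖ ≤ M * Real.exp (ω * (t - τ))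

theorem ExpStable.expBounded {𝒰 : EvolutionFamily X} (h : 𝒰.ExpStable) : 𝒰.ExpBounded :=
  let ⟨M, ω, hM, _, hU⟩ := h
  ⟨M, ω, hM, hU⟩

open Classical in
/-- `(E^t f)(τ) = U(τ, τ - t) f(τ - t)` if `0 ≤ t ≤ τ`, and `0` if `0 ≤ τ < t`
(and `0` for the irrelevant `t < 0`). -/
noncomputable def evolFun (𝒰 : EvolutionFamily X) (t : ℝ) (f : ℝ → X) (τ : ℝ) : X :=
  if 0 ≤ t ∧ t ≤ τ then 𝒰.U τ (τ - t) (f (τ - t)) else 0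

theorem measurePreserving_shift (t : ℝ) :
    MeasurePreserving (fun τ : ℝ => τ - t) (volume.restrict (Ici t)) halfLine := by
  have h := (measurePreserving_sub_right (volume : Measure ℝ) t).restrict_preimage
    (measurableSet_Ici (a := (0 : ℝ)))
  have e : (fun τ : ℝ => τ - t) ⁻¹' Ici 0 = Ici t := by
    ext τ
    simp
  rwa [e] at h

theorem evolFun_eq_indicator (𝒰 : EvolutionFamily X) {t : ℝ} (ht : 0 ≤ t) (f : ℝ → X) :
    𝒰.evolFun t f = (Ici t).indicator (fun τ => 𝒰.U τ (τ - t) (f (τ - t))) := by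
  funext τ
  simp [evolFun, indicator, ht]

theorem evolFun_of_neg (𝒰 : EvolutionFamily X) {t : ℝ} (ht : t < 0) (f : ℝ → X) :
    𝒰.evolFun t f = 0 := by
  funext τ
  simp [evolFun, not_le.2 ht]

theorem halfLine_restrict {t : ℝ} (ht : 0 ≤ t) :
    halfLine.restrict (Ici t) = volume.restrict (Ici t) := by
  rw [Measure.restrict_restrict measurableSet_Ici,
    inter_eq_left.2 (Ici_subset_Ici.2 ht)]

theorem evolFun_congr (𝒰 : EvolutionFamily X) (t : ℝ) {f g : ℝ → X} (h : f =ᵐ[halfLine] g) :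
    𝒰.evolFun t f =ᵐ[halfLine] 𝒰.evolFun t g := by
  rcases lt_or_ge t 0 with ht | ht
  · rw [evolFun_of_neg _ ht, evolFun_of_neg _ ht]
  · have h' := (measurePreserving_shift t).quasiMeasurePreserving.ae_eq_comp h
    rw [← halfLine_restrict ht, Filter.EventuallyEq, ae_restrict_iff' measurableSet_Ici] at h'
    filter_upwards [h'] with τ hτ
    unfold evolFun
    split_ifs with hc
    · have := hτ hc.2
      simp only [Function.comp_apply] at this
      rw [this]
    · rfl

theorem evolFun_aestronglyMeasurable (𝒰 : EvolutionFamily X) (t : ℝ) {f : ℝ → X}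
    (hf : AEStronglyMeasurable f halfLine) : AEStronglyMeasurable (𝒰.evolFun t f) halfLine := by
  rcases lt_or_ge t 0 with ht | ht
  · rw [evolFun_of_neg _ ht]
    exact aestronglyMeasurable_zero
  · rw [evolFun_eq_indicator _ ht, aestronglyMeasurable_indicator_iff measurableSet_Ici,
      halfLine_restrict ht]
    refine aestronglyMeasurable_strong_apply (T := fun τ => 𝒰.U τ (τ - t)) (fun x => ?_)
      (hf.comp_measurePreserving (measurePreserving_shift t))
    refine ContinuousOn.aestronglyMeasurable ?_ measurableSet_Ici
    refine (𝒰.strong_cont x).comp (f := fun τ : ℝ => (τ, τ - t)) (by fun_prop) ?_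
    intro τ hτ
    have : t ≤ τ := hτ
    constructor <;> simp <;> linarith

theorem ExpBounded.exists_evolFun_le {𝒰 : EvolutionFamily X} (h : 𝒰.ExpBounded) (p : ℝ≥0∞)
    (t : ℝ) : ∃ K : ℝ≥0, ∀ f : ℝ → X, AEStronglyMeasurable f halfLine →
      eLpNorm (𝒰.evolFun t f) p halfLine ≤ K * eLpNorm f p halfLine := by
  obtain ⟨M, ω, hM, hU⟩ := h
  refine ⟨⟨M * Real.exp (ω * t), by positivity⟩, fun f hf => ?_⟩
  rcases lt_or_ge t 0 with ht | ht
  · rw [evolFun_of_neg _ ht]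
    simp
  · rw [evolFun_eq_indicator _ ht, eLpNorm_indicator_eq_eLpNorm_restrict measurableSet_Ici,
      halfLine_restrict ht]
    have e : eLpNorm (fun τ => f (τ - t)) p (volume.restrict (Ici t)) = eLpNorm f p halfLine :=
      eLpNorm_comp_measurePreserving hf (measurePreserving_shift t)
    rw [← e]
    refine eLpNorm_le_nnreal_smul_eLpNorm_of_ae_le_mul ?_ p
    filter_upwards [ae_restrict_mem measurableSet_Ici] with τ hτ
    have hτ' : t ≤ τ := hτ
    have := (𝒰.U τ (τ - t)).le_of_opNorm_le
      (hU (τ - t) τ (by linarith) (by linarith)) (f (τ - t))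
    rw [sub_sub_cancel] at this
    exact_mod_cast this

theorem ExpBounded.evolFun_memLp {𝒰 : EvolutionFamily X} (h : 𝒰.ExpBounded) {p : ℝ≥0∞}
    (t : ℝ) (f : Lp X p halfLine) : MemLp (𝒰.evolFun t f) p halfLine := by
  obtain ⟨K, hK⟩ := h.exists_evolFun_le p t
  exact ⟨𝒰.evolFun_aestronglyMeasurable t (Lp.aestronglyMeasurable f),
    (hK f (Lp.aestronglyMeasurable f)).trans_lt
      (ENNReal.mul_lt_top ENNReal.coe_lt_top (Lp.eLpNorm_lt_top f))⟩

/-- The evolution semigroup operator `E^t` on `L^p(ℝ₊, X)`. -/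
noncomputable def evolOp (𝒰 : EvolutionFamily X) (h : 𝒰.ExpBounded) (p : ℝ≥0∞) [Fact (1 ≤ p)]
    (t : ℝ) : Lp X p halfLine →L[ℂ] Lp X p halfLine :=
  LinearMap.mkContinuous
    { toFun := fun f => (h.evolFun_memLp t f).toLp _
      map_add' := fun f g => by
        rw [← MemLp.toLp_add, MemLp.toLp_eq_toLp_iff]
        refine (𝒰.evolFun_congr t (Lp.coeFn_add f g)).trans (Eventually.of_forall fun τ => ?_)
        simp only [evolFun, Pi.add_apply]
        split_ifs <;> simp
      map_smul' := fun c f => by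
        rw [RingHom.id_apply, ← MemLp.toLp_const_smul, MemLp.toLp_eq_toLp_iff]
        refine (𝒰.evolFun_congr t (Lp.coeFn_smul c f)).trans (Eventually.of_forall fun τ => ?_)
        simp only [evolFun, Pi.smul_apply]
        split_ifs <;> simp }
    ((Classical.choose (h.exists_evolFun_le p t) : ℝ≥0) : ℝ)
    (fun f => by
      have := Classical.choose_spec (h.exists_evolFun_le p t) f (Lp.aestronglyMeasurable f)
      have h2 := ENNReal.toReal_mono
        (ENNReal.mul_ne_top ENNReal.coe_ne_top (Lp.eLpNorm_ne_top f)) this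
      rw [ENNReal.toReal_mul, ENNReal.coe_toReal] at h2
      rw [LinearMap.coe_mk, AddHom.coe_mk, Lp.norm_toLp, Lp.norm_def]
      exact h2)

/-- The generator `Γ` of the evolution semigroup `{E^t}_{t ≥ 0}` on `L^p(ℝ₊, X)`. -/
noncomputable def evolGenerator (𝒰 : EvolutionFamily X) (h : 𝒰.ExpBounded) (p : ℝ≥0∞)
    [Fact (1 ≤ p)] : Lp X p halfLine →ₗ.[ℂ] Lp X p halfLine :=
  semigroupGenerator (𝒰.evolOp h p)

/-- `(𝔾 f)(t) = ∫_0^t U(t, τ) f(τ) dτ`. -/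
noncomputable def green (𝒰 : EvolutionFamily X) (f : ℝ → X) (t : ℝ) : X :=
  ∫ τ in (0 : ℝ)..t, 𝒰.U t τ (f τ)

variable {V Y : Type*} [NormedAddCommGroup V] [NormedSpace ℂ V]
  [NormedAddCommGroup Y] [NormedSpace ℂ Y]

/-- The input-output map `(𝕃 u)(t) = C(t) ∫_0^t U(t, τ) B(τ) u(τ) dτ`. -/
noncomputable def inputOutput (𝒰 : EvolutionFamily X) (B : StrongLinfty V X) (C : StrongLinfty X Y)
    (u : ℝ → V) (t : ℝ) : Y :=
  C.op t (∫ τ in (0 : ℝ)..t, 𝒰.U t τ (B.op τ (u τ)))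

/-- `𝒲` is the evolution family `𝒰_Δ` of the perturbed system, i.e. for all `t ≥ s ≥ 0`, `x`
`W(t,s) x = U(t,s) x + ∫_s^t U(t,τ) B(τ) Δ(τ) C(τ) W(τ,s) x dτ`. -/
def IsPerturbation (𝒰 : EvolutionFamily X) (B : StrongLinfty V X) (C : StrongLinfty X Y)
    (Δ : StrongLinfty Y V) (𝒲 : EvolutionFamily X) : Prop :=
  ∀ s t, 0 ≤ s → s ≤ t → ∀ x, 𝒲.U t s x =
    𝒰.U t s x + ∫ τ in s..t, 𝒰.U t τ (B.op τ (Δ.op τ (C.op τ (𝒲.U τ s x))))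

/-- The (complex) stability radius
`r_stab(𝒰, B, C) = sup {r ≥ 0 : ‖Δ(·)‖_∞ ≤ r ⇒ 𝒰_Δ is exponentially stable} ∈ [0, ∞]`. -/
noncomputable def stabRadius (𝒰 : EvolutionFamily X) (B : StrongLinfty V X)
    (C : StrongLinfty X Y) : ℝ≥0∞ :=
  ⨆ (r : ℝ≥0) (_ : ∀ Δ : StrongLinfty Y V, Δ.essNorm ≤ r →
    ∃ 𝒲 : EvolutionFamily X, 𝒰.IsPerturbation B C Δ 𝒲 ∧ 𝒲.ExpStable), (r : ℝ≥0∞)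

end EvolutionFamily

/-! Exponential stability dominates `𝔾` by convolution with `M e^{ωr} 1_{r ≥ 0}`, so Young's
inequality bounds it on `L^p`. The cocycle law turns `𝔾f - E^t 𝔾f` into the integral of `U(τ, s)
f(s)` over the window from `max (τ - t) 0` to `τ`. Divided by `t` it tends to `f` in `L^p`
(`tendsto_average`), and `𝔾` commutes with `E^t`; hence `Γ⁻¹ = -𝔾`
(`isBoundedInverse_evolGenerator`).

The lower bound is a small-gain argument. After an exponential rescaling the Volterra equation for
`𝒰_Δ` has a contractive integral operator, so `𝒰_Δ` exists (`ExpBounded.exists_volterraSolution`).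
If `w` is an orbit cut off to `[s, T]` and `z = 𝒞w`, then `‖z‖ ≤ ‖𝒞‖ ‖U(·, s)x‖ + ‖𝕃‖ ‖Δ‖_∞ ‖z‖`.
When `‖𝕃‖ ‖Δ‖_∞ < 1` this bounds `z`, and then `w`, in `L^p` uniformly in `s` and `T`, and Datko's
theorem (`expStable_of_eLpNorm_le`) gives stability.

The upper bound tests the constant perturbation `Δ = rI`. By uniqueness `𝒰_Δ` is `e^{r(t-s)} U(t,
s)`. If this is stable, so is `e^{ν(t-s)} U(t, s)` for every complex `|ν| ≤ r`. The generator
attached to the latter is `Γ + ν`, so `1 + νΓ⁻¹` is invertible on the whole disc and `r(Γ⁻¹) ≤ 1/r`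
(`spectralRadius_greenOp_le`). -/

/-- **Young's convolution inequality** `L¹ * L^p → L^p` for nonnegative functions. -/
theorem lintegral_rpow_lintegral_sub_mul_le {μ : Measure ℝ} [SFinite μ] (hμ : μ ≤ volume)
    {k h : ℝ → ℝ≥0∞} (hk : Measurable k) (hh : AEMeasurable h μ) {p : ℝ} (hp : 1 ≤ p) :
    ∫⁻ t, (∫⁻ s, k (t - s) * h s ∂μ) ^ p ∂μ ≤ (∫⁻ r, k r) ^ p * ∫⁻ s, h s ^ p ∂μ := by
  have hp0 : 0 < p := by linarith
  set K := ∫⁻ r, k r with hK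
  have left_le : ∀ t, ∫⁻ s, k (t - s) ∂μ ≤ K := fun t =>
    (lintegral_mono' hμ le_rfl).trans (lintegral_sub_left_eq_self k t).le
  have right_le : ∀ s, ∫⁻ t, k (t - s) ∂μ ≤ K := fun s =>
    (lintegral_mono' hμ le_rfl).trans (lintegral_sub_right_eq_self k s).le
  -- Hölder after splitting `k = k^{1/p} k^{1/q}`. The exponent `p = 1`, which has no finite
  -- conjugate, is immediate.
  have holder : ∀ t, (∫⁻ s, k (t - s) * h s ∂μ) ^ p
      ≤ K ^ (p - 1) * ∫⁻ s, k (t - s) * h s ^ p ∂μ := by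
    intro t
    rcases hp.eq_or_lt with rfl | hp1
    · simp
    have hc := Real.HolderConjugate.conjExponent hp1
    set q := p.conjExponent
    have hq0 : 0 < q := hc.symm.pos
    have e : ∀ s, k (t - s) * h s = (k (t - s) ^ (1 / p) * h s) * k (t - s) ^ (1 / q) := by
      intro s
      rw [mul_right_comm, ← ENNReal.rpow_add_of_nonneg _ _ (by positivity) (by positivity)]
      have : 1 / p + 1 / q = 1 := by simpa using hc.inv_add_inv_eq_one
      rw [this, ENNReal.rpow_one]
    have hkt : Measurable fun s => k (t - s) := hk.comp (measurable_const.sub measurable_id)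
    have H := ENNReal.lintegral_mul_le_Lp_mul_Lq μ hc
      (f := fun s => k (t - s) ^ (1 / p) * h s) (g := fun s => k (t - s) ^ (1 / q))
      ((hkt.pow_const _).aemeasurable.mul hh) (hkt.pow_const _).aemeasurable
    simp only [Pi.mul_apply] at H
    simp_rw [← e] at H
    refine (ENNReal.rpow_le_rpow H hp0.le).trans ?_
    rw [ENNReal.mul_rpow_of_nonneg _ _ hp0.le, ← ENNReal.rpow_mul, ← ENNReal.rpow_mul,
      one_div_mul_cancel hp0.ne', ENNReal.rpow_one, mul_comm]
    have e1 : 1 / q * p = p - 1 := by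
      have := hc.inv_add_inv_eq_one
      have h2 : q⁻¹ = 1 - p⁻¹ := by linarith
      rw [one_div, h2]
      field_simp
    rw [e1]
    gcongr ?_ * ?_
    · refine ENNReal.rpow_le_rpow (le_trans (le_of_eq ?_) (left_le t)) (by linarith)
      refine lintegral_congr fun s => ?_
      rw [← ENNReal.rpow_mul, one_div_mul_cancel hq0.ne', ENNReal.rpow_one]
    · refine (lintegral_congr fun s => ?_).le
      rw [ENNReal.mul_rpow_of_nonneg _ _ hp0.le, ← ENNReal.rpow_mul,
        one_div_mul_cancel hp0.ne', ENNReal.rpow_one]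
  have hprod : AEMeasurable (fun z : ℝ × ℝ => k (z.1 - z.2) * h z.2 ^ p) (μ.prod μ) :=
    (hk.comp (measurable_fst.sub measurable_snd)).aemeasurable.mul (hh.comp_snd.pow_const _)
  calc ∫⁻ t, (∫⁻ s, k (t - s) * h s ∂μ) ^ p ∂μ
      ≤ ∫⁻ t, K ^ (p - 1) * ∫⁻ s, k (t - s) * h s ^ p ∂μ ∂μ := lintegral_mono holder
    _ = K ^ (p - 1) * ∫⁻ t, ∫⁻ s, k (t - s) * h s ^ p ∂μ ∂μ :=
        lintegral_const_mul'' _ hprod.lintegral_prod_right'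
    _ = K ^ (p - 1) * ∫⁻ s, ∫⁻ t, k (t - s) * h s ^ p ∂μ ∂μ := by
        rw [lintegral_lintegral_swap hprod]
    _ ≤ K ^ (p - 1) * ∫⁻ s, K * h s ^ p ∂μ := by
        gcongr with s
        have hks : Measurable fun t => k (t - s) := hk.comp (measurable_id.sub measurable_const)
        rw [lintegral_mul_const _ hks]
        gcongr
        exact right_le s
    _ = K ^ p * ∫⁻ s, h s ^ p ∂μ := by
        rw [lintegral_const_mul'' _ (hh.pow_const _), ← mul_assoc]
        congr 1
        nth_rw 2 [← ENNReal.rpow_one K]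
        rw [← ENNReal.rpow_add_of_nonneg _ _ (by linarith) zero_le_one, sub_add_cancel]

/-- A function dominated by a convolution `k * ‖f‖` on the half-line has `L^p`-norm at most
`‖k‖₁ ‖f‖_p`. -/
theorem eLpNorm_le_of_enorm_le_lintegral_sub_mul {E F : Type*} [NormedAddCommGroup E]
    [NormedAddCommGroup F] {p : ℝ≥0∞} (hp1 : 1 ≤ p) (hp : p ≠ ∞) {k : ℝ → ℝ≥0∞}
    (hk : Measurable k) {f : ℝ → E} (hf : AEStronglyMeasurable f halfLine) {g : ℝ → F}
    (hg : ∀ᵐ t ∂halfLine, ‖g t‖ₑ ≤ ∫⁻ s, k (t - s) * ‖f s‖ₑ ∂halfLine) :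
    eLpNorm g p halfLine ≤ (∫⁻ r, k r) * eLpNorm f p halfLine := by
  have hp0 : p ≠ 0 := (zero_lt_one.trans_le hp1).ne'
  have hpr : 1 ≤ p.toReal := by
    simpa using ENNReal.toReal_mono hp hp1
  have hpr0 : 0 < p.toReal := by linarith
  rw [eLpNorm_eq_lintegral_rpow_enorm_toReal hp0 hp, eLpNorm_eq_lintegral_rpow_enorm_toReal hp0 hp]
  have H := lintegral_rpow_lintegral_sub_mul_le (μ := halfLine) Measure.restrict_le_self hk
    hf.enorm hpr
  have H2 : ∫⁻ t, ‖g t‖ₑ ^ p.toReal ∂halfLine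
      ≤ (∫⁻ r, k r) ^ p.toReal * ∫⁻ s, ‖f s‖ₑ ^ p.toReal ∂halfLine := by
    refine le_trans (lintegral_mono_ae ?_) H
    filter_upwards [hg] with t ht
    exact ENNReal.rpow_le_rpow ht hpr0.le
  refine (ENNReal.rpow_le_rpow H2 (by positivity)).trans_eq ?_
  rw [ENNReal.mul_rpow_of_nonneg _ _ (by positivity), ← ENNReal.rpow_mul,
    mul_one_div_cancel hpr0.ne', ENNReal.rpow_one]

namespace EvolutionFamily

variable {X : Type*} [NormedAddCommGroup X] [NormedSpace ℂ X]

/-! ### Volterra integrals against an evolution family -/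

theorem halfLine_restrict_Ioc {s : ℝ} (hs : 0 ≤ s) (t : ℝ) :
    halfLine.restrict (Ioc s t) = volume.restrict (Ioc s t) := by
  rw [Measure.restrict_restrict measurableSet_Ioc,
    inter_eq_left.2 (show Ioc s t ⊆ Ici 0 from fun τ hτ => hs.trans hτ.1.le)]

theorem ExpBounded.exists_norm_le {𝒰 : EvolutionFamily X} (h : 𝒰.ExpBounded) (T : ℝ) :
    ∃ K : ℝ, 0 ≤ K ∧ ∀ τ t, 0 ≤ τ → τ ≤ t → t ≤ T → ‖𝒰.U t τ‖ ≤ K := by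
  obtain ⟨M, ω, hM, hU⟩ := h
  refine ⟨M * Real.exp (|ω| * |T|), by positivity, fun τ t h0 h1 h2 => (hU τ t h0 h1).trans ?_⟩
  gcongr ?_ * Real.exp ?_
  calc ω * (t - τ) ≤ |ω| * |t - τ| := (le_abs_self _).trans (abs_mul _ _).le
    _ ≤ |ω| * |T| := by
      gcongr |ω| * ?_
      rw [abs_of_nonneg (sub_nonneg.2 h1), abs_of_nonneg (by linarith)]
      linarith

theorem aestronglyMeasurable_apply (𝒰 : EvolutionFamily X) {s : ℝ} (hs : 0 ≤ s) (t : ℝ)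
    {g : ℝ → X} (hg : AEStronglyMeasurable g halfLine) :
    AEStronglyMeasurable (fun τ => 𝒰.U t τ (g τ)) (volume.restrict (Ioc s t)) := by
  refine aestronglyMeasurable_strong_apply (T := fun τ => 𝒰.U t τ) (fun x => ?_)
    (hg.mono_measure (Measure.restrict_mono (fun τ hτ => hs.trans hτ.1.le) le_rfl))
  refine ContinuousOn.aestronglyMeasurable ?_ measurableSet_Ioc
  exact (𝒰.strong_cont x).comp (f := fun τ : ℝ => (t, τ)) (by fun_prop)
    fun τ hτ => ⟨hs.trans hτ.1.le, hτ.2⟩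

theorem ExpBounded.intervalIntegrable_apply {𝒰 : EvolutionFamily X} (h : 𝒰.ExpBounded)
    {s t : ℝ} (hs : 0 ≤ s) (hst : s ≤ t) {g : ℝ → X} (hg : AEStronglyMeasurable g halfLine)
    (hi : IntegrableOn g (Ioc s t)) :
    IntervalIntegrable (fun τ => 𝒰.U t τ (g τ)) volume s t := by
  rw [intervalIntegrable_iff_integrableOn_Ioc_of_le hst]
  obtain ⟨K, hK0, hK⟩ := h.exists_norm_le t
  refine Integrable.mono' (hi.norm.const_mul K) (𝒰.aestronglyMeasurable_apply hs t hg) ?_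
  filter_upwards [ae_restrict_mem measurableSet_Ioc] with τ hτ
  exact (𝒰.U t τ).le_of_opNorm_le (hK τ t (hs.trans hτ.1.le) hτ.2 le_rfl) _

/-- Dominated convergence: with the moving limits absorbed into an indicator, the integrand
converges for all `τ` outside a null set. This serves both the Green function and the Volterra
operator. -/
theorem ExpBounded.continuousOn_integral {𝒰 : EvolutionFamily X} (h : 𝒰.ExpBounded)
    {g : ℝ → ℝ → X} (hm : ∀ s, AEStronglyMeasurable (g s) halfLine)
    (hc : ∀ᵐ τ ∂halfLine, Continuous fun s => g s τ) {b : ℝ → ℝ}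
    (hb : ∀ s, ∀ᵐ τ ∂halfLine, ‖g s τ‖ ≤ b τ) (hbi : ∀ T, IntegrableOn b (Icc 0 T)) :
    ContinuousOn (fun q : ℝ × ℝ => ∫ τ in q.2..q.1, 𝒰.U q.1 τ (g q.2 τ))
      {q | 0 ≤ q.2 ∧ q.2 ≤ q.1} := by
  set F : ℝ × ℝ → ℝ → X := fun q => (Ioc q.2 q.1).indicator fun τ => 𝒰.U q.1 τ (g q.2 τ)
  have hF : ∀ q ∈ {q : ℝ × ℝ | 0 ≤ q.2 ∧ q.2 ≤ q.1},
      ∫ τ in q.2..q.1, 𝒰.U q.1 τ (g q.2 τ) = ∫ τ, F q τ ∂halfLine := by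
    intro q hq
    rw [intervalIntegral.integral_of_le hq.2, integral_indicator measurableSet_Ioc,
      halfLine_restrict_Ioc hq.1]
  refine ContinuousOn.congr ?_ hF
  rintro ⟨t₀, s₀⟩ h₀
  obtain ⟨hs₀, hst₀⟩ : 0 ≤ s₀ ∧ s₀ ≤ t₀ := h₀
  obtain ⟨K, hK0, hK⟩ := h.exists_norm_le (t₀ + 1)
  have near : ∀ᶠ q : ℝ × ℝ in 𝓝[{q | 0 ≤ q.2 ∧ q.2 ≤ q.1}] (t₀, s₀),
      0 ≤ q.2 ∧ q.2 ≤ q.1 ∧ q.1 ≤ t₀ + 1 := by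
    have h1 : ∀ᶠ q : ℝ × ℝ in 𝓝 (t₀, s₀), q.1 < t₀ + 1 :=
      continuous_fst.continuousAt.eventually_lt continuousAt_const (by simp)
    filter_upwards [self_mem_nhdsWithin, mem_nhdsWithin_of_mem_nhds h1] with q hq hq'
    exact ⟨hq.1, hq.2, le_of_lt hq'⟩
  refine continuousWithinAt_of_dominated
    (bound := (Icc 0 (t₀ + 1)).indicator fun τ => K * b τ) ?_ ?_ ?_ ?_
  · filter_upwards [near] with q hq
    rw [aestronglyMeasurable_indicator_iff measurableSet_Ioc,
      halfLine_restrict_Ioc hq.1]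
    exact 𝒰.aestronglyMeasurable_apply hq.1 q.1 (hm q.2)
  · filter_upwards [near] with q hq
    filter_upwards [hb q.2] with τ hτ
    by_cases hmem : τ ∈ Ioc q.2 q.1
    · rw [show F q τ = 𝒰.U q.1 τ (g q.2 τ) from indicator_of_mem hmem _, indicator_of_mem
        (show τ ∈ Icc 0 (t₀ + 1) from ⟨hq.1.trans hmem.1.le, hmem.2.trans hq.2.2⟩)]
      exact ((𝒰.U q.1 τ).le_of_opNorm_le
        (hK τ q.1 (hq.1.trans hmem.1.le) hmem.2 hq.2.2) _).trans (by gcongr)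
    · rw [show F q τ = 0 from indicator_of_notMem hmem _, norm_zero]
      exact indicator_apply_nonneg fun _ => (mul_nonneg hK0 ((norm_nonneg _).trans hτ))
  · exact (IntegrableOn.integrable_indicator ((hbi (t₀ + 1)).const_mul K) measurableSet_Icc).mono_measure
      Measure.restrict_le_self
  -- The indicator can jump in the limit only at the endpoints `τ = s₀` and `τ = t₀`, which are
  -- null.
  · have ne : ∀ a : ℝ, ∀ᵐ τ ∂halfLine, τ ≠ a := fun a =>
      ae_restrict_of_ae (Measure.ae_ne volume a)
    filter_upwards [ne t₀, ne s₀, hc] with τ hτt hτs hcτ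
    have cont1 : Tendsto (fun q : ℝ × ℝ => q.1) (𝓝[{q | 0 ≤ q.2 ∧ q.2 ≤ q.1}] (t₀, s₀)) (𝓝 t₀) :=
      (continuous_fst.tendsto (t₀, s₀)).mono_left nhdsWithin_le_nhds
    have cont2 : Tendsto (fun q : ℝ × ℝ => q.2) (𝓝[{q | 0 ≤ q.2 ∧ q.2 ≤ q.1}] (t₀, s₀)) (𝓝 s₀) :=
      (continuous_snd.tendsto (t₀, s₀)).mono_left nhdsWithin_le_nhds
    change Tendsto (fun q => F q τ) _ (𝓝 (F (t₀, s₀) τ))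
    rcases lt_or_gt_of_ne hτs with h1 | h1
    · have e : F (t₀, s₀) τ = 0 := indicator_of_notMem (fun hm => absurd hm.1 (not_lt.2 h1.le)) _
      rw [e]
      refine tendsto_const_nhds.congr' ?_
      filter_upwards [cont2.eventually_const_lt h1] with q hq
      exact (indicator_of_notMem (fun hm => absurd hm.1 (not_lt.2 hq.le)) _).symm
    rcases lt_or_gt_of_ne hτt with h2 | h2
    · have e : F (t₀, s₀) τ = 𝒰.U t₀ τ (g s₀ τ) := 
        indicator_of_mem (show τ ∈ Ioc s₀ t₀ from ⟨h1, h2.le⟩) _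
      rw [e]
      have A : Tendsto (fun q : ℝ × ℝ => 𝒰.U q.1 τ (g s₀ τ))
          (𝓝[{q | 0 ≤ q.2 ∧ q.2 ≤ q.1}] (t₀, s₀)) (𝓝 (𝒰.U t₀ τ (g s₀ τ))) := by
        have := (𝒰.strong_cont (g s₀ τ)) (t₀, τ) ⟨hs₀.trans h1.le, h2.le⟩
        refine this.tendsto.comp (tendsto_nhdsWithin_iff.2
          ⟨cont1.prodMk_nhds tendsto_const_nhds, ?_⟩)
        filter_upwards [cont1.eventually_const_lt h2] with q hq
        exact ⟨hs₀.trans h1.le, hq.le⟩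
      -- Strong continuity controls `U(·, τ)` only on a fixed vector; the moving remainder is killed
      -- by the local bound `K`.
      have B : Tendsto (fun q : ℝ × ℝ => 𝒰.U q.1 τ (g q.2 τ - g s₀ τ))
          (𝓝[{q | 0 ≤ q.2 ∧ q.2 ≤ q.1}] (t₀, s₀)) (𝓝 0) := by
        have c0 : Tendsto (fun q : ℝ × ℝ => K * ‖g q.2 τ - g s₀ τ‖)
            (𝓝[{q | 0 ≤ q.2 ∧ q.2 ≤ q.1}] (t₀, s₀)) (𝓝 0) := by
          have := (((hcτ.tendsto s₀).comp cont2).sub_const (g s₀ τ)).norm.const_mul K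
          simpa using this
        refine squeeze_zero_norm' ?_ c0
        filter_upwards [near, cont1.eventually_const_lt h2] with q hq hq'
        exact (𝒰.U q.1 τ).le_of_opNorm_le (hK τ q.1 (hs₀.trans h1.le) hq'.le hq.2.2) _
      have AB := A.add B
      rw [add_zero] at AB
      refine AB.congr' ?_
      filter_upwards [cont1.eventually_const_lt h2, cont2.eventually_lt_const h1] with q hq hq'
      have e2 : F q τ = 𝒰.U q.1 τ (g q.2 τ) := 
        indicator_of_mem (show τ ∈ Ioc q.2 q.1 from ⟨hq', hq.le⟩) _
      rw [e2, map_sub, add_sub_cancel]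
    · have e : F (t₀, s₀) τ = 0 := indicator_of_notMem (fun hm => absurd hm.2 (not_le.2 h2)) _
      rw [e]
      refine tendsto_const_nhds.congr' ?_
      filter_upwards [cont1.eventually_lt_const h2] with q hq
      exact (indicator_of_notMem (fun hm => absurd hm.2 (not_le.2 hq)) _).symm

theorem integrableOn_of_memLp {E : Type*} [NormedAddCommGroup E] {p : ℝ≥0∞} (hp1 : 1 ≤ p)
    {f : ℝ → E} (hf : MemLp f p halfLine) {s : ℝ} (hs : 0 ≤ s) (T : ℝ) : IntegrableOn f (Icc s T) := by
  have : MemLp f p (volume.restrict (Icc s T)) :=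
    hf.mono_measure (Measure.restrict_mono (fun τ hτ => hs.trans hτ.1) le_rfl)
  exact this.integrable hp1

theorem ExpBounded.intervalIntegrable_of_memLp {𝒰 : EvolutionFamily X} (h : 𝒰.ExpBounded)
    {p : ℝ≥0∞} (hp1 : 1 ≤ p) {f : ℝ → X} (hf : MemLp f p halfLine) {s t : ℝ} (hs : 0 ≤ s)
    (hst : s ≤ t) : IntervalIntegrable (fun τ => 𝒰.U t τ (f τ)) volume s t :=
  h.intervalIntegrable_apply hs hst hf.1
    ((integrableOn_of_memLp hp1 hf hs t).mono_set Ioc_subset_Icc_self)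

theorem ExpBounded.continuousOn_green {𝒰 : EvolutionFamily X} (h : 𝒰.ExpBounded)
    {p : ℝ≥0∞} (hp1 : 1 ≤ p) {f : ℝ → X} (hf : MemLp f p halfLine) :
    ContinuousOn (𝒰.green f) (Ici 0) := by
  have := h.continuousOn_integral (g := fun _ => f) (b := fun τ => ‖f τ‖) (fun _ => hf.1)
    (Eventually.of_forall fun _ => continuous_const) (fun _ => Eventually.of_forall fun _ => le_rfl)
    (fun T => (integrableOn_of_memLp hp1 hf le_rfl T).norm)
  exact this.comp (f := fun t : ℝ => (t, (0 : ℝ))) (by fun_prop) fun t ht => ⟨le_rfl, ht⟩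

/-! ### The Green operator -/

/-- The exponential kernel `M e^{ωr} 1_{r ≥ 0}` has mass `M / (-ω)`. -/
theorem lintegral_exp_kernel {M ω : ℝ} (hM : 0 ≤ M) (hω : ω < 0) :
    ∫⁻ r, (Ici (0 : ℝ)).indicator (fun r => ENNReal.ofReal (M * Real.exp (ω * r))) r
      = ENNReal.ofReal (M / -ω) := by
  rw [lintegral_indicator measurableSet_Ici, ← ofReal_integral_eq_lintegral_ofReal]
  · rw [integral_const_mul, integral_Ici_eq_integral_Ioi, integral_exp_mul_Ioi hω]
    simp [div_eq_mul_inv]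
  · exact ((integrableOn_Ici_iff_integrableOn_Ioi (by simp)).2 (integrableOn_exp_mul_Ioi hω 0)).const_mul M
  · exact Eventually.of_forall fun r => by positivity

theorem measurable_indicator_kernel {S : Set ℝ} (hS : MeasurableSet S) {k : ℝ → ℝ}
    (hk : Continuous k) :
    Measurable (S.indicator fun r => ENNReal.ofReal (k r)) :=
  hk.measurable.ennreal_ofReal.indicator hS

theorem enorm_intervalIntegral_le_lintegral {F : Type*} [NormedAddCommGroup F] [NormedSpace ℝ F]
    {f : ℝ → F} {φ : ℝ → ℝ≥0∞} {a t : ℝ}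
    (ha : 0 ≤ a) (hat : a ≤ t) (h : ∀ τ ∈ Ioc a t, ‖f τ‖ₑ ≤ φ τ) :
    ‖∫ τ in a..t, f τ‖ₑ ≤ ∫⁻ τ, φ τ ∂halfLine := by
  rw [intervalIntegral.integral_of_le hat]
  refine (enorm_integral_le_lintegral_enorm _).trans ?_
  refine (setLIntegral_mono' measurableSet_Ioc h).trans ?_
  exact lintegral_mono' (Measure.restrict_mono (fun τ hτ => ha.trans hτ.1.le) le_rfl) le_rfl

variable {𝒰 : EvolutionFamily X} {p : ℝ≥0∞} {M ω : ℝ}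

/-- Young's inequality with the exponential kernel, whose mass is the constant. -/
theorem eLpNorm_green_le (hp1 : 1 ≤ p) (hp : p ≠ ∞) (hM : 0 ≤ M) (hω : ω < 0)
    (hU : ∀ τ t, 0 ≤ τ → τ ≤ t → ‖𝒰.U t τ‖ ≤ M * Real.exp (ω * (t - τ)))
    {f : ℝ → X} (hf : AEStronglyMeasurable f halfLine) :
    eLpNorm (𝒰.green f) p halfLine ≤ ENNReal.ofReal (M / -ω) * eLpNorm f p halfLine := by
  rw [← lintegral_exp_kernel hM hω]
  refine eLpNorm_le_of_enorm_le_lintegral_sub_mul hp1 hp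
    (measurable_indicator_kernel measurableSet_Ici (by fun_prop)) hf ?_
  filter_upwards [ae_restrict_mem measurableSet_Ici] with t ht
  refine enorm_intervalIntegral_le_lintegral le_rfl ht fun τ hτ => ?_
  rw [indicator_of_mem (show t - τ ∈ Ici (0 : ℝ) from sub_nonneg.2 hτ.2)]
  refine ((𝒰.U t τ).le_opENorm _).trans ?_
  gcongr
  rw [← ofReal_norm]
  exact ENNReal.ofReal_le_ofReal (hU τ t hτ.1.le hτ.2)

theorem ExpStable.green_memLp (h : 𝒰.ExpStable) (hp1 : 1 ≤ p) (hp : p ≠ ∞) {f : ℝ → X}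
    (hf : MemLp f p halfLine) : MemLp (𝒰.green f) p halfLine := by
  obtain ⟨M, ω, hM, hω, hU⟩ := id h
  refine ⟨(h.expBounded.continuousOn_green hp1 hf).aestronglyMeasurable measurableSet_Ici,
    (eLpNorm_green_le hp1 hp (by linarith) hω hU hf.1).trans_lt
    (ENNReal.mul_lt_top ENNReal.ofReal_lt_top hf.2)⟩

/-- Integration ignores null sets, so equality holds at every `t ≥ 0` and `𝔾` descends to `L^p`
classes. -/
theorem green_congr {f g : ℝ → X} (h : f =ᵐ[halfLine] g) {t : ℝ} (ht : 0 ≤ t) :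
    𝒰.green f t = 𝒰.green g t := by
  refine intervalIntegral.integral_congr_ae_restrict ?_
  rw [uIoc_of_le ht]
  have : f =ᵐ[volume.restrict (Ioc 0 t)] g :=
    ae_restrict_of_ae_restrict_of_subset (fun τ hτ => hτ.1.le) h
  filter_upwards [this] with τ hτ
  rw [hτ]

/-- The Green operator `𝔾` on `L^p(ℝ₊, X)`. -/
noncomputable def greenOp (𝒰 : EvolutionFamily X) (h : 𝒰.ExpStable) (p : ℝ≥0∞) [Fact (1 ≤ p)]
    (hp : p ≠ ∞) : Lp X p halfLine →L[ℂ] Lp X p halfLine :=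
  LinearMap.mkContinuous
    { toFun := fun f => (h.green_memLp Fact.out hp (Lp.memLp f)).toLp _
      map_add' := fun f g => by
        rw [← MemLp.toLp_add, MemLp.toLp_eq_toLp_iff]
        filter_upwards [ae_restrict_mem measurableSet_Ici] with t ht
        rw [green_congr (Lp.coeFn_add f g) ht, Pi.add_apply]
        simp only [green, Pi.add_apply, map_add]
        exact intervalIntegral.integral_add
          (h.expBounded.intervalIntegrable_of_memLp Fact.out (Lp.memLp f) le_rfl ht)
          (h.expBounded.intervalIntegrable_of_memLp Fact.out (Lp.memLp g) le_rfl ht)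
      map_smul' := fun c f => by
        rw [RingHom.id_apply, ← MemLp.toLp_const_smul, MemLp.toLp_eq_toLp_iff]
        filter_upwards [ae_restrict_mem measurableSet_Ici] with t ht
        rw [green_congr (Lp.coeFn_smul c f) ht, Pi.smul_apply]
        simp only [green, Pi.smul_apply, map_smul]
        exact intervalIntegral.integral_smul c _ }
    (h.choose / -h.choose_spec.choose)
    (fun f => by
      obtain ⟨hM, hω, hU⟩ := h.choose_spec.choose_spec
      have H := eLpNorm_green_le (Fact.out : 1 ≤ p) hp (by linarith) hω hU
        (Lp.aestronglyMeasurable f)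
      have H2 := ENNReal.toReal_mono
        (ENNReal.mul_ne_top ENNReal.ofReal_ne_top (Lp.eLpNorm_ne_top f)) H
      rw [ENNReal.toReal_mul, ENNReal.toReal_ofReal
        (div_nonneg (by linarith) (by linarith))] at H2
      rw [LinearMap.coe_mk, AddHom.coe_mk, Lp.norm_toLp, Lp.norm_def]
      exact H2)

theorem coeFn_greenOp (h : 𝒰.ExpStable) [Fact (1 ≤ p)] (hp : p ≠ ∞) (f : Lp X p halfLine) :
    𝒰.greenOp h p hp f =ᵐ[halfLine] 𝒰.green f :=
  (h.green_memLp Fact.out hp (Lp.memLp f)).coeFn_toLp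

end EvolutionFamily

/-! ### Inverting the generator -/

section Generator

variable {E : Type*} [NormedAddCommGroup E] [NormedSpace ℂ E] {T : ℝ → E →L[ℂ] E}

theorem semigroupGenerator_tendsto (x : (semigroupGenerator T).domain) :
    Tendsto (fun t : ℝ => t⁻¹ • (T t x - x)) (𝓝[>] 0) (𝓝 (semigroupGenerator T x)) :=
  Classical.choose_spec x.2

theorem semigroupGenerator_eq_of_tendsto {x y : E}
    (h : Tendsto (fun t : ℝ => t⁻¹ • (T t x - x)) (𝓝[>] 0) (𝓝 y)) :
    ∃ hx : x ∈ (semigroupGenerator T).domain, semigroupGenerator T ⟨x, hx⟩ = y :=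
  ⟨⟨y, h⟩, tendsto_nhds_unique (semigroupGenerator_tendsto (T := T) ⟨x, ⟨y, h⟩⟩) h⟩

/-- If `t⁻¹ (T(t) - I) G f → -f` and `G` commutes with `T`, then `-G` inverts the generator. -/
theorem isBoundedInverse_semigroupGenerator {G : E →L[ℂ] E}
    (hlim : ∀ f, Tendsto (fun t : ℝ => t⁻¹ • (G f - T t (G f))) (𝓝[>] 0) (𝓝 f))
    (hcomm : ∀ t, 0 ≤ t → ∀ f, G (T t f) = T t (G f)) :
    IsBoundedInverse (semigroupGenerator T) (-G) := by
  refine ⟨fun x => ?_, fun y => ?_⟩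
  -- By commutation, `G` applied to the difference quotient of `x` is the negative of the quotient
  -- in `hlim`, so `G A x = -x`.
  · have h1 := (G.continuous.tendsto _).comp (semigroupGenerator_tendsto x)
    have h2 := (hlim x).neg
    refine (neg_eq_iff_eq_neg).2 (tendsto_nhds_unique h1 (h2.congr' ?_))
    filter_upwards [self_mem_nhdsWithin] with t ht
    simp only [Function.comp_apply]
    rw [← smul_neg, neg_sub, ContinuousLinearMap.map_smul_of_tower, map_sub,
      hcomm t (le_of_lt ht)]
  · refine semigroupGenerator_eq_of_tendsto ((hlim y).congr fun t => ?_)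
    simp only [neg_apply, map_neg]
    congr 1
    abel

end Generator

namespace EvolutionFamily

variable {X : Type*} [NormedAddCommGroup X] [NormedSpace ℂ X]
  {𝒰 : EvolutionFamily X} {p : ℝ≥0∞}

theorem coeFn_evolOp (h : 𝒰.ExpBounded) [Fact (1 ≤ p)] (t : ℝ) (f : Lp X p halfLine) :
    𝒰.evolOp h p t f =ᵐ[halfLine] 𝒰.evolFun t f :=
  (h.evolFun_memLp t f).coeFn_toLp

theorem ExpStable.exists_norm_le (h : 𝒰.ExpStable) :
    ∃ M : ℝ, 1 ≤ M ∧ ∀ τ t, 0 ≤ τ → τ ≤ t → ‖𝒰.U t τ‖ ≤ M := by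
  obtain ⟨M, ω, hM, hω, hU⟩ := h
  refine ⟨M, hM, fun τ t h0 h1 => (hU τ t h0 h1).trans ?_⟩
  refine mul_le_of_le_one_right (by linarith) (Real.exp_le_one_iff.2 ?_)
  exact mul_nonpos_of_nonpos_of_nonneg hω.le (sub_nonneg.2 h1)

variable [CompleteSpace X]

theorem apply_green (h : 𝒰.ExpBounded) (hp1 : 1 ≤ p) {f : ℝ → X} (hf : MemLp f p halfLine)
    {σ τ : ℝ} (hσ : 0 ≤ σ) (hστ : σ ≤ τ) :
    𝒰.U τ σ (𝒰.green f σ) = ∫ s in (0 : ℝ)..σ, 𝒰.U τ s (f s) := by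
  rw [green, ← ContinuousLinearMap.intervalIntegral_comp_comm _
    (h.intervalIntegrable_of_memLp hp1 hf le_rfl hσ)]
  refine intervalIntegral.integral_congr fun s hs => ?_
  rw [uIcc_of_le hσ] at hs
  simp only [𝒰.comp s σ τ hs.1 hs.2 hστ, ContinuousLinearMap.comp_apply]

/-- By the cocycle law, `E^t` carries the part of the integral over `[0, τ - t]` up to time `τ`;
only the last window survives. The `max` covers `τ < t`, where `E^t` contributes nothing. -/
theorem green_sub_evolFun_green (h : 𝒰.ExpBounded) (hp1 : 1 ≤ p) {f : ℝ → X}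
    (hf : MemLp f p halfLine) {t τ : ℝ} (ht : 0 ≤ t) (hτ : 0 ≤ τ) :
    𝒰.green f τ - 𝒰.evolFun t (𝒰.green f) τ = ∫ s in max (τ - t) 0..τ, 𝒰.U τ s (f s) := by
  rcases le_or_gt t τ with h1 | h1
  · rw [evolFun, if_pos ⟨ht, h1⟩, apply_green h hp1 hf (sub_nonneg.2 h1) (by linarith),
      max_eq_left (sub_nonneg.2 h1)]
    have i := h.intervalIntegrable_of_memLp hp1 hf le_rfl hτ
    refine intervalIntegral.integral_interval_sub_left i (i.mono_set ?_)
    rw [uIcc_of_le (sub_nonneg.2 h1), uIcc_of_le hτ]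
    exact Icc_subset_Icc_right (by linarith)
  · rw [evolFun, if_neg (fun hc => absurd hc.2 (not_le.2 h1)), max_eq_right (by linarith),
      sub_zero, green]

/-- The substitution `s ↦ s - t` together with the cocycle law; `E^t f` vanishes before time `t`. -/
theorem green_evolFun (h : 𝒰.ExpBounded) (hp1 : 1 ≤ p) {f : ℝ → X} (hf : MemLp f p halfLine)
    {t τ : ℝ} (ht : 0 ≤ t) (hτ : 0 ≤ τ) (hft : MemLp (𝒰.evolFun t f) p halfLine) :
    𝒰.green (𝒰.evolFun t f) τ = 𝒰.evolFun t (𝒰.green f) τ := by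
  have zero : ∀ a, 0 ≤ a → a ≤ t → ∫ s in (0 : ℝ)..a, 𝒰.U τ s (𝒰.evolFun t f s) = 0 := by
    intro a ha hat
    -- The half-open interval must omit its right endpoint: `E^t f` need not vanish at `s = t`.
    rw [intervalIntegral.integral_of_le ha, ← integral_Ico_eq_integral_Ioc]
    refine setIntegral_eq_zero_of_forall_eq_zero fun s hs => ?_
    rw [evolFun, if_neg fun hc => absurd hc.2 (not_le.2 (hs.2.trans_le hat)), map_zero]
  rcases le_or_gt t τ with h1 | h1
  · rw [evolFun, if_pos ⟨ht, h1⟩, apply_green h hp1 hf (sub_nonneg.2 h1) (by linarith), green]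
    have i := h.intervalIntegrable_of_memLp hp1 hft le_rfl hτ
    rw [← intervalIntegral.integral_add_adjacent_intervals (b := t)
      (i.mono_set (by rw [uIcc_of_le ht, uIcc_of_le hτ]; exact Icc_subset_Icc_right h1))
      (i.mono_set (by rw [uIcc_of_le h1, uIcc_of_le hτ]; exact Icc_subset_Icc_left ht)),
      zero t ht le_rfl, zero_add]
    have e := intervalIntegral.integral_comp_sub_right (a := t) (b := τ)
      (fun s => 𝒰.U τ s (f s)) t
    rw [sub_self] at e
    rw [← e]
    refine intervalIntegral.integral_congr fun s hs => ?_
    rw [uIcc_of_le h1] at hs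
    simp only [evolFun, if_pos (show 0 ≤ t ∧ t ≤ s from ⟨ht, hs.1⟩)]
    rw [𝒰.comp (s - t) s τ (sub_nonneg.2 hs.1) (by linarith) hs.2,
      ContinuousLinearMap.comp_apply]
  · rw [evolFun, if_neg (fun hc => absurd hc.2 (not_le.2 h1)), green, zero τ hτ h1.le]

variable [Fact (1 ≤ p)] (hp : p ≠ ∞)

theorem greenOp_evolOp (h : 𝒰.ExpStable) {t : ℝ} (ht : 0 ≤ t) (f : Lp X p halfLine) :
    𝒰.greenOp h p hp (𝒰.evolOp h.expBounded p t f)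
      = 𝒰.evolOp h.expBounded p t (𝒰.greenOp h p hp f) := by
  refine Lp.ext ?_
  filter_upwards [coeFn_greenOp h hp (𝒰.evolOp h.expBounded p t f),
    coeFn_evolOp h.expBounded t (𝒰.greenOp h p hp f),
    𝒰.evolFun_congr t (coeFn_greenOp h hp f), ae_restrict_mem measurableSet_Ici]
    with τ h1 h2 h3 hτ
  rw [h1, h2, h3, green_congr (coeFn_evolOp h.expBounded t f) hτ]
  exact green_evolFun h.expBounded Fact.out (Lp.memLp f) ht hτ
    (h.expBounded.evolFun_memLp t f)

theorem coeFn_greenOp_sub (h : 𝒰.ExpStable) {t : ℝ} (ht : 0 ≤ t) {f : ℝ → X}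
    (hf : MemLp f p halfLine) :
    𝒰.greenOp h p hp (hf.toLp f) - 𝒰.evolOp h.expBounded p t (𝒰.greenOp h p hp (hf.toLp f))
      =ᵐ[halfLine] fun τ => ∫ s in max (τ - t) 0..τ, 𝒰.U τ s (f s) := by
  have hG : 𝒰.greenOp h p hp (hf.toLp f) =ᵐ[halfLine] 𝒰.green f := by
    filter_upwards [coeFn_greenOp h hp (hf.toLp f), ae_restrict_mem measurableSet_Ici]
      with τ h1 hτ
    rw [h1, green_congr hf.coeFn_toLp hτ]
  filter_upwards [Lp.coeFn_sub (𝒰.greenOp h p hp (hf.toLp f))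
      (𝒰.evolOp h.expBounded p t (𝒰.greenOp h p hp (hf.toLp f))), hG,
    coeFn_evolOp h.expBounded t (𝒰.greenOp h p hp (hf.toLp f)),
    𝒰.evolFun_congr t hG, ae_restrict_mem measurableSet_Ici] with τ h1 h2 h3 h4 hτ
  rw [h1, Pi.sub_apply, h2, h3, h4]
  exact green_sub_evolFun_green h.expBounded Fact.out hf ht hτ

/-- Young's inequality with kernel `M 1_{[0,t]}`, of mass `Mt`. After division by `t` the quotients
are bounded uniformly in `t`, as the density argument requires. -/
theorem norm_greenOp_sub_le (h : 𝒰.ExpStable) {M : ℝ} (hM : 0 ≤ M)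
    (hU : ∀ τ t, 0 ≤ τ → τ ≤ t → ‖𝒰.U t τ‖ ≤ M) {t : ℝ} (ht : 0 ≤ t) (f : Lp X p halfLine) :
    ‖𝒰.greenOp h p hp f - 𝒰.evolOp h.expBounded p t (𝒰.greenOp h p hp f)‖ ≤ M * t * ‖f‖ := by
  have H := coeFn_greenOp_sub hp h ht (Lp.memLp f)
  rw [Lp.toLp_coeFn] at H
  have hk : ∫⁻ r, (Icc 0 t).indicator (fun _ => ENNReal.ofReal M) r = ENNReal.ofReal (M * t) := by
    rw [lintegral_indicator measurableSet_Icc, setLIntegral_const, Real.volume_Icc, sub_zero,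
      ENNReal.ofReal_mul hM]
  have Y : eLpNorm (𝒰.greenOp h p hp f
      - 𝒰.evolOp h.expBounded p t (𝒰.greenOp h p hp f) : Lp X p halfLine) p halfLine
      ≤ ENNReal.ofReal (M * t) * eLpNorm f p halfLine := by
    rw [← hk]
    refine eLpNorm_le_of_enorm_le_lintegral_sub_mul Fact.out hp
      (measurable_indicator_kernel measurableSet_Icc continuous_const)
      (Lp.aestronglyMeasurable f) ?_
    filter_upwards [H, ae_restrict_mem measurableSet_Ici] with τ h1 hτ
    rw [h1]
    refine enorm_intervalIntegral_le_lintegral (le_max_right _ _)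
      (max_le (by linarith) hτ) fun s hs => ?_
    have hs1 := (le_max_left _ _).trans_lt hs.1
    have hs0 := (le_max_right _ _).trans_lt hs.1
    rw [indicator_of_mem (show τ - s ∈ Icc 0 t from ⟨sub_nonneg.2 hs.2, by linarith⟩)]
    refine ((𝒰.U τ s).le_opENorm _).trans ?_
    gcongr
    rw [← ofReal_norm]
    exact ENNReal.ofReal_le_ofReal (hU s τ hs0.le hs.2)
  have := ENNReal.toReal_mono (ENNReal.mul_ne_top ENNReal.ofReal_ne_top (Lp.eLpNorm_ne_top f)) Y
  rwa [ENNReal.toReal_mul, ENNReal.toReal_ofReal (by positivity), ← Lp.norm_def,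
    ← Lp.norm_def] at this

/-- The fundamental theorem of calculus at the right endpoint: `s ↦ U(τ, s) g(s)` is continuous on
`[0, τ]` with value `g(τ)` at `s = τ`. -/
theorem tendsto_average_apply {g : ℝ → X} (hg : Continuous g) {M : ℝ}
    (hU : ∀ τ t, 0 ≤ τ → τ ≤ t → ‖𝒰.U t τ‖ ≤ M) {τ : ℝ} (hτ : 0 < τ) :
    Tendsto (fun t : ℝ => t⁻¹ • ∫ s in max (τ - t) 0..τ, 𝒰.U τ s (g s)) (𝓝[>] 0) (𝓝 (g τ)) := by
  have cont : ContinuousOn (fun s => 𝒰.U τ s (g s)) (Icc 0 τ) := by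
    intro s₀ hs₀
    have A : Tendsto (fun s => 𝒰.U τ s (g s₀)) (𝓝[Icc 0 τ] s₀) (𝓝 (𝒰.U τ s₀ (g s₀))) :=
      ((𝒰.strong_cont (g s₀)).comp (f := fun s : ℝ => (τ, s)) (by fun_prop)
        (fun s hs => hs)) s₀ hs₀
    have B : Tendsto (fun s => 𝒰.U τ s (g s - g s₀)) (𝓝[Icc 0 τ] s₀) (𝓝 0) := by
      have c0 : Tendsto (fun s => M * ‖g s - g s₀‖) (𝓝[Icc 0 τ] s₀) (𝓝 0) := by
        have := (((hg.tendsto s₀).mono_left nhdsWithin_le_nhds).sub_const (g s₀)).norm.const_mul M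
          (f := fun s => ‖g s - g s₀‖) (x := 𝓝[Icc 0 τ] s₀)
        simpa using this
      refine squeeze_zero_norm' ?_ c0
      filter_upwards [self_mem_nhdsWithin] with s hs
      exact (𝒰.U τ s).le_of_opNorm_le (hU s τ hs.1 hs.2) _
    have AB := A.add B
    rw [add_zero] at AB
    refine AB.congr fun s => ?_
    rw [map_sub, add_sub_cancel]
  have lim : Tendsto (fun s => 𝒰.U τ s (g s)) (𝓝[Icc 0 τ] τ) (𝓝 (g τ)) := by
    have := cont τ ⟨hτ.le, le_rfl⟩
    rwa [ContinuousWithinAt, 𝒰.self τ hτ.le] at this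
  rw [Metric.tendsto_nhds]
  intro ε hε
  obtain ⟨δ, hδ, hlim⟩ := Metric.mem_nhdsWithin_iff.1
    (Metric.tendsto_nhds.1 lim (ε / 2) (by positivity))
  filter_upwards [Ioo_mem_nhdsGT (lt_min hδ hτ)] with t ht
  have ht0 : 0 < t := ht.1
  have htδ : t < δ := ht.2.trans_le (min_le_left _ _)
  have htτ : t < τ := ht.2.trans_le (min_le_right _ _)
  rw [max_eq_left (by linarith), dist_eq_norm]
  have hle : τ - t ≤ τ := by linarith
  have i : IntervalIntegrable (fun s => 𝒰.U τ s (g s)) volume (τ - t) τ := by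
    refine ContinuousOn.intervalIntegrable (cont.mono ?_)
    rw [uIcc_of_le hle]
    exact Icc_subset_Icc_left (by linarith)
  have e : t⁻¹ • (∫ s in (τ - t)..τ, 𝒰.U τ s (g s)) - g τ
      = t⁻¹ • ∫ s in (τ - t)..τ, (𝒰.U τ s (g s) - g τ) := by
    rw [intervalIntegral.integral_sub i intervalIntegrable_const, intervalIntegral.integral_const,
      sub_sub_cancel, smul_sub, inv_smul_smul₀ ht0.ne']
  rw [e, norm_smul]
  have b := intervalIntegral.norm_integral_le_of_norm_le_const (a := τ - t) (b := τ)
    (C := ε / 2) (f := fun s => 𝒰.U τ s (g s) - g τ) (fun s hs => by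
      rw [uIoc_of_le hle] at hs
      rw [← dist_eq_norm]
      refine le_of_lt (hlim ⟨?_, ?_, hs.2⟩)
      · rw [Metric.mem_ball, Real.dist_eq, abs_lt]
        constructor <;> linarith [hs.1, hs.2]
      · linarith [hs.1])
  rw [sub_sub_cancel, abs_of_pos ht0] at b
  rw [norm_inv, Real.norm_of_nonneg ht0.le]
  calc t⁻¹ * ‖∫ s in (τ - t)..τ, (𝒰.U τ s (g s) - g τ)‖ ≤ t⁻¹ * (ε / 2 * t) := by gcongr
    _ = ε / 2 := by field_simp
    _ < ε := by linarith

theorem tendsto_average_of_hasCompactSupport (h : 𝒰.ExpStable) {g : ℝ → X} (hg : Continuous g)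
    (hgs : HasCompactSupport g) (hgp : MemLp g p halfLine) :
    Tendsto (fun t : ℝ => t⁻¹ • (𝒰.greenOp h p hp (hgp.toLp g)
      - 𝒰.evolOp h.expBounded p t (𝒰.greenOp h p hp (hgp.toLp g)))) (𝓝[>] 0)
      (𝓝 (hgp.toLp g)) := by
  obtain ⟨M, hM, hU⟩ := h.exists_norm_le
  obtain ⟨C, hC⟩ := hg.bounded_above_of_compact_support hgs
  have hC0 : 0 ≤ C := (norm_nonneg _).trans (hC 0)
  obtain ⟨R, hR⟩ : ∃ R, ∀ s, R < s → g s = 0 := by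
    obtain ⟨R, hR⟩ := hgs.isCompact.bddAbove
    exact ⟨R, fun s hs => by
      by_contra hne
      exact absurd (hR (subset_tsupport g hne)) (not_le.2 hs)⟩
  set D : ℝ → Lp X p halfLine := fun t => t⁻¹ • (𝒰.greenOp h p hp (hgp.toLp g)
      - 𝒰.evolOp h.expBounded p t (𝒰.greenOp h p hp (hgp.toLp g)))
  have hp0 : p ≠ 0 := (zero_lt_one.trans_le (Fact.out : 1 ≤ p)).ne'
  have hpr : 0 < p.toReal := ENNReal.toReal_pos hp0 hp
  have coe : ∀ t, 0 ≤ t → (D t - hgp.toLp g : Lp X p halfLine) =ᵐ[halfLine]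
      fun τ => t⁻¹ • (∫ s in max (τ - t) 0..τ, 𝒰.U τ s (g s)) - g τ := by
    intro t ht
    filter_upwards [Lp.coeFn_sub (D t) (hgp.toLp g), hgp.coeFn_toLp,
      Lp.coeFn_smul t⁻¹ (𝒰.greenOp h p hp (hgp.toLp g)
        - 𝒰.evolOp h.expBounded p t (𝒰.greenOp h p hp (hgp.toLp g))),
      coeFn_greenOp_sub hp h ht hgp] with τ h1 h2 h3 h4
    rw [h1, Pi.sub_apply, h2, h3, Pi.smul_apply, h4]
  rw [← tendsto_sub_nhds_zero_iff, tendsto_zero_iff_norm_tendsto_zero]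
  simp_rw [Lp.norm_def]
  suffices H : Tendsto (fun t => ∫⁻ τ, ‖(D t - hgp.toLp g : Lp X p halfLine) τ‖ₑ ^ p.toReal
      ∂halfLine) (𝓝[>] 0) (𝓝 0) by
    have H2 := (ENNReal.continuous_rpow_const (y := 1 / p.toReal)).tendsto 0 |>.comp H
    rw [ENNReal.zero_rpow_of_pos (by positivity)] at H2
    have H3 := (ENNReal.tendsto_toReal ENNReal.zero_ne_top).comp H2
    refine H3.congr fun t => ?_
    simp only [Function.comp_apply]
    rw [eLpNorm_eq_lintegral_rpow_enorm_toReal hp0 hp]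
  have small : ∀ᶠ t : ℝ in 𝓝[>] 0, t ∈ Ioo (0 : ℝ) 1 := Ioo_mem_nhdsGT one_pos
  have main : Tendsto (fun t : ℝ => ∫⁻ τ, ‖t⁻¹ • (∫ s in max (τ - t) 0..τ, 𝒰.U τ s (g s)) - g τ‖ₑ
      ^ p.toReal ∂halfLine) (𝓝[>] 0) (𝓝 (∫⁻ _ : ℝ, 0 ∂halfLine)) := by
    refine tendsto_lintegral_filter_of_dominated_convergence'
      -- The average contributes `M * C` and `g` contributes `C`. For `t < 1` and `τ > R + 1` the
      -- window from `τ - t` to `τ` lies beyond `R`, where `g` vanishes.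
      (bound := (Icc 0 (R + 1)).indicator fun _ => ENNReal.ofReal (M * C + C) ^ p.toReal)
      ?_ ?_ ?_ ?_
    · filter_upwards [small] with t ht
      exact (((Lp.aestronglyMeasurable (D t - hgp.toLp g)).congr
        (coe t ht.1.le)).enorm).pow_const _
    · filter_upwards [small] with t ht
      filter_upwards [ae_restrict_mem measurableSet_Ici] with τ hτ
      have hle : max (τ - t) 0 ≤ τ := max_le (by linarith [ht.1]) hτ
      by_cases hmem : τ ∈ Icc 0 (R + 1)
      · rw [indicator_of_mem hmem]
        refine ENNReal.rpow_le_rpow ?_ hpr.le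
        rw [← ofReal_norm]
        refine ENNReal.ofReal_le_ofReal ((norm_sub_le _ _).trans (add_le_add ?_ (hC τ)))
        rw [norm_smul, norm_inv, Real.norm_of_nonneg ht.1.le, inv_mul_le_iff₀ ht.1]
        refine (intervalIntegral.norm_integral_le_of_norm_le_const (C := M * C)
          fun s hs => ?_).trans ?_
        · rw [uIoc_of_le hle] at hs
          exact (𝒰.U τ s).le_of_opNorm_le_of_le
            (hU s τ ((le_max_right _ _).trans hs.1.le) hs.2) (hC s)
        · rw [mul_comm, abs_of_nonneg (by linarith)]
          gcongr
          linarith [le_max_left (τ - t) 0]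
      · have hτR : R + 1 < τ := by
          by_contra hc
          exact hmem ⟨hτ, not_lt.1 hc⟩
        have : ∫ s in max (τ - t) 0..τ, 𝒰.U τ s (g s) = 0 := by
          rw [intervalIntegral.integral_of_le hle]
          refine setIntegral_eq_zero_of_forall_eq_zero fun s hs => ?_
          rw [hR s (by linarith [hs.1, le_max_left (τ - t) 0, ht.2]), map_zero]
        rw [this, hR τ (by linarith), smul_zero, sub_zero, enorm_zero,
          ENNReal.zero_rpow_of_pos hpr]
        exact zero_le
    · rw [lintegral_indicator measurableSet_Icc, setLIntegral_const]
      refine ENNReal.mul_ne_top (ENNReal.rpow_ne_top_of_nonneg hpr.le ENNReal.ofReal_ne_top) ?_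
      refine ((Measure.restrict_apply_le _ _).trans_lt ?_).ne
      exact measure_Icc_lt_top
    · filter_upwards [ae_restrict_mem measurableSet_Ici,
        ae_restrict_of_ae (Measure.ae_ne volume (0 : ℝ))] with τ hτ hτ0
      have L := tendsto_average_apply hg hU (lt_of_le_of_ne hτ hτ0.symm)
      have L2 := (L.sub_const (g τ)).enorm
      rw [sub_self, enorm_zero] at L2
      have L3 := (ENNReal.continuous_rpow_const (y := p.toReal)).tendsto 0 |>.comp L2
      rwa [ENNReal.zero_rpow_of_pos hpr] at L3
  rw [lintegral_zero] at main
  refine main.congr' ?_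
  filter_upwards [small] with t ht
  refine lintegral_congr_ae ?_
  filter_upwards [coe t ht.1.le] with τ hτ
  rw [hτ]

theorem tendsto_average (h : 𝒰.ExpStable) (f : Lp X p halfLine) :
    Tendsto (fun t : ℝ => t⁻¹ • (𝒰.greenOp h p hp f
      - 𝒰.evolOp h.expBounded p t (𝒰.greenOp h p hp f))) (𝓝[>] 0) (𝓝 f) := by
  obtain ⟨M, hM, hU⟩ := h.exists_norm_le
  rw [Metric.tendsto_nhds]
  intro ε hε
  -- The error has three parts: `M * η` from the quotient of `f - G`, `η` from convergence at `G`,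
  -- and `η` from `f - G` itself.
  set η : ℝ := ε / (M + 2) with hη
  have hη0 : 0 < η := by positivity
  obtain ⟨g, hgs, hfg, hgc, hgp⟩ := (Lp.memLp f).exists_hasCompactSupport_eLpNorm_sub_le hp
    (ε := ENNReal.ofReal η) (by simpa using hη0)
  set G : Lp X p halfLine := hgp.toLp g
  have hfG : ‖f - G‖ ≤ η := by
    have e : f - G = ((Lp.memLp f).sub hgp).toLp _ := by
      rw [MemLp.toLp_sub (Lp.memLp f) hgp, Lp.toLp_coeFn f (Lp.memLp f)]
    rw [e, Lp.norm_toLp]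
    exact ENNReal.toReal_le_of_le_ofReal hη0.le hfg
  filter_upwards [Metric.tendsto_nhds.1
    (tendsto_average_of_hasCompactSupport hp h hgc hgs hgp) η hη0, self_mem_nhdsWithin] with t ht ht0
  have ht0 : 0 < t := ht0
  rw [dist_eq_norm] at ht ⊢
  have key : t⁻¹ • (𝒰.greenOp h p hp f - 𝒰.evolOp h.expBounded p t (𝒰.greenOp h p hp f)) - f
      = t⁻¹ • (𝒰.greenOp h p hp (f - G) - 𝒰.evolOp h.expBounded p t (𝒰.greenOp h p hp (f - G)))
        + (t⁻¹ • (𝒰.greenOp h p hp G - 𝒰.evolOp h.expBounded p t (𝒰.greenOp h p hp G)) - G)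
        - (f - G) := by
    simp only [map_sub, smul_sub]
    abel
  have b1 : ‖t⁻¹ • (𝒰.greenOp h p hp (f - G)
      - 𝒰.evolOp h.expBounded p t (𝒰.greenOp h p hp (f - G)))‖ ≤ M * η := by
    rw [norm_smul, norm_inv, Real.norm_of_nonneg ht0.le, inv_mul_le_iff₀ ht0]
    refine (norm_greenOp_sub_le hp h (by linarith) hU ht0.le (f - G)).trans ?_
    rw [mul_comm M t, mul_assoc]
    gcongr
  calc _ ≤ M * η + ‖t⁻¹ • (𝒰.greenOp h p hp G
            - 𝒰.evolOp h.expBounded p t (𝒰.greenOp h p hp G)) - G‖ + η := by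
          rw [key]
          exact (norm_sub_le _ _).trans (add_le_add ((norm_add_le _ _).trans
            (add_le_add b1 le_rfl)) hfG)
    _ < M * η + η + η := by gcongr
    _ = ε := by rw [hη]; field_simp; ring

/-- `Γ` is invertible and `Γ⁻¹ = -𝔾`. -/
theorem isBoundedInverse_evolGenerator (h : 𝒰.ExpStable) :
    IsBoundedInverse (𝒰.evolGenerator h.expBounded p) (-𝒰.greenOp h p hp) :=
  isBoundedInverse_semigroupGenerator (tendsto_average hp h) fun _ ht f => greenOp_evolOp hp h ht f

end EvolutionFamily

/-! ### Products of operator-valued functions -/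

namespace StrongLinfty

variable {E F G : Type*} [NormedAddCommGroup E] [NormedSpace ℂ E]
  [NormedAddCommGroup F] [NormedSpace ℂ F] [NormedAddCommGroup G] [NormedSpace ℂ G]

theorem ae_enorm_op_le (D : StrongLinfty E F) : ∀ᵐ t ∂halfLine, ‖D.op t‖ₑ ≤ D.essNorm :=
  ae_le_essSup (f := fun t => ‖D.op t‖ₑ) (μ := halfLine)

theorem ae_norm_op_le (D : StrongLinfty E F) : ∀ᵐ t ∂halfLine, ‖D.op t‖ ≤ D.essNorm.toReal := by
  filter_upwards [D.ae_enorm_op_le] with t ht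
  have := ENNReal.toReal_mono (show D.essNorm ≠ ∞ from D.ess_bdd.ne) ht
  rwa [toReal_enorm] at this

/-- Pointwise composition of operator-valued functions. -/
noncomputable def comp (A : StrongLinfty F G) (D : StrongLinfty E F) : StrongLinfty E G where
  op := fun t => A.op t ∘L D.op t
  strongly_meas := fun x =>
    aestronglyMeasurable_strong_apply A.strongly_meas (D.strongly_meas x)
  ess_bdd := by
    refine lt_of_le_of_lt (essSup_le_of_ae_le (A.essNorm * D.essNorm) ?_)
      (ENNReal.mul_lt_top A.ess_bdd D.ess_bdd)
    filter_upwards [A.ae_enorm_op_le, D.ae_enorm_op_le] with t h1 h2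
    refine le_trans ?_ (mul_le_mul' h1 h2)
    rw [← ofReal_norm, ← ofReal_norm, ← ofReal_norm, ← ENNReal.ofReal_mul (norm_nonneg _)]
    exact ENNReal.ofReal_le_ofReal (ContinuousLinearMap.opNorm_comp_le _ _)

end StrongLinfty

namespace EvolutionFamily

variable {X : Type*} [NormedAddCommGroup X] [NormedSpace ℂ X]

/-! ### Exponential rescaling -/

/-- The rescaled evolution family `e^{μ (t - s)} U(t, s)`. -/
noncomputable def rescale (𝒰 : EvolutionFamily X) (μ : ℂ) : EvolutionFamily X where
  U := fun t s => Complex.exp (μ * (t - s)) • 𝒰.U t s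
  comp := fun τ s t h0 h1 h2 => by
    rw [𝒰.comp τ s t h0 h1 h2, ContinuousLinearMap.smul_comp, ContinuousLinearMap.comp_smul,
      smul_smul, ← Complex.exp_add]
    congr 2
    ring
  self := fun t ht => by simp [𝒰.self t ht]
  strong_cont := fun x => by
    refine ContinuousOn.smul (Continuous.continuousOn ?_) (𝒰.strong_cont x)
    fun_prop

theorem rescale_apply (𝒰 : EvolutionFamily X) (μ : ℂ) (t s : ℝ) (x : X) :
    (𝒰.rescale μ).U t s x = Complex.exp (μ * (t - s)) • 𝒰.U t s x := rfl

theorem rescale_rescale_neg (𝒰 : EvolutionFamily X) (μ : ℂ) :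
    (𝒰.rescale μ).rescale (-μ) = 𝒰 := by
  have : ((𝒰.rescale μ).rescale (-μ)).U = 𝒰.U := by
    funext t s
    ext x
    simp only [rescale_apply, smul_smul, ← Complex.exp_add]
    simp
  cases 𝒰
  simpa [rescale] using this

theorem norm_rescale (𝒰 : EvolutionFamily X) (μ : ℂ) (t s : ℝ) :
    ‖(𝒰.rescale μ).U t s‖ = Real.exp (μ.re * (t - s)) * ‖𝒰.U t s‖ := by
  change ‖Complex.exp (μ * (t - s)) • 𝒰.U t s‖ = _
  rw [norm_smul, Complex.norm_exp]
  congr 2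
  rw [← Complex.ofReal_sub, Complex.re_mul_ofReal]

theorem norm_rescale_le {𝒰 : EvolutionFamily X} {M ω : ℝ}
    (hU : ∀ τ t, 0 ≤ τ → τ ≤ t → ‖𝒰.U t τ‖ ≤ M * Real.exp (ω * (t - τ))) (μ : ℂ) :
    ∀ τ t, 0 ≤ τ → τ ≤ t → ‖(𝒰.rescale μ).U t τ‖ ≤ M * Real.exp ((ω + μ.re) * (t - τ)) := by
  intro τ t h0 h1
  rw [norm_rescale]
  calc _ ≤ Real.exp (μ.re * (t - τ)) * (M * Real.exp (ω * (t - τ))) := by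
        gcongr
        exact hU τ t h0 h1
    _ = _ := by rw [add_mul, Real.exp_add]; ring

theorem ExpBounded.rescale {𝒰 : EvolutionFamily X} (h : 𝒰.ExpBounded) (μ : ℂ) :
    (𝒰.rescale μ).ExpBounded :=
  let ⟨M, ω, hM, hU⟩ := h
  ⟨M, ω + μ.re, hM, norm_rescale_le hU μ⟩

/-! ### The perturbed Volterra equation -/

/-- `𝒲` solves `W(t,s) x = U(t,s) x + ∫_s^t U(t,τ) D(τ) W(τ,s) x dτ`. -/
def IsVolterraSolution (𝒰 : EvolutionFamily X) (D : ℝ → X →L[ℂ] X) (𝒲 : EvolutionFamily X) :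
    Prop :=
  ∀ s t, 0 ≤ s → s ≤ t → ∀ x, 𝒲.U t s x =
    𝒰.U t s x + ∫ τ in s..t, 𝒰.U t τ (D τ (𝒲.U τ s x))

/-- The factor `e^{μ(t-s)} = e^{μ(t-τ)} e^{μ(τ-s)}` distributes over the two families under the
integral and leaves `D` untouched. -/
theorem IsVolterraSolution.rescale {𝒰 𝒲 : EvolutionFamily X} {D : ℝ → X →L[ℂ] X}
    (h : 𝒰.IsVolterraSolution D 𝒲) (μ : ℂ) :
    (𝒰.rescale μ).IsVolterraSolution D (𝒲.rescale μ) := by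
  intro s t h0 h1 x
  rw [rescale_apply, rescale_apply, h s t h0 h1 x, smul_add, ← intervalIntegral.integral_smul]
  congr 1
  refine intervalIntegral.integral_congr fun τ _ => ?_
  simp only [rescale_apply, map_smul, smul_smul, ← Complex.exp_add]
  congr 2
  ring

theorem integral_exp_neg_sub_le {δ : ℝ} (hδ : 0 < δ) (s t : ℝ) :
    ∫ τ in s..t, Real.exp (-δ * (t - τ)) ≤ δ⁻¹ := by
  have e := intervalIntegral.integral_comp_sub_left (a := s) (b := t)
    (fun r => Real.exp (-δ * r)) t
  rw [e, sub_self, intervalIntegral.integral_comp_mul_left (fun r => Real.exp r) (by linarith),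
    integral_exp, mul_zero, Real.exp_zero, smul_eq_mul, inv_neg, neg_mul, ← mul_neg, neg_sub]
  refine mul_le_of_le_one_right (by positivity) ?_
  linarith [Real.exp_pos (-δ * (t - s))]

variable {𝒰 : EvolutionFamily X} {M ω K : ℝ} {D : ℝ → X →L[ℂ] X}

/-- Measured against the weight `e^{l(τ-s)}`, the kernel decays at rate `l - ω`, and that
exponential integrates to at most `1/(l - ω)`. A large `l` thus makes the Volterra operator a
contraction. -/
theorem norm_volterra_integral_le (hM : 0 ≤ M)
    (hU : ∀ τ t, 0 ≤ τ → τ ≤ t → ‖𝒰.U t τ‖ ≤ M * Real.exp (ω * (t - τ))) (hK : 0 ≤ K)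
    (hD : ∀ᵐ τ ∂halfLine, ‖D τ‖ ≤ K) {l : ℝ} (hl : ω < l) {s t : ℝ} (hs : 0 ≤ s) (hst : s ≤ t)
    {v : ℝ → X} {c : ℝ} (hc : 0 ≤ c)
    (hv : ∀ τ, s ≤ τ → τ ≤ t → ‖v τ‖ ≤ c * Real.exp (l * (τ - s))) :
    ‖∫ τ in s..t, 𝒰.U t τ (D τ (v τ))‖ ≤ M * K / (l - ω) * c * Real.exp (l * (t - s)) := by
  have hδ : 0 < l - ω := sub_pos.2 hl
  have b : ‖∫ τ in s..t, 𝒰.U t τ (D τ (v τ))‖ ≤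
      ∫ τ in s..t, (M * K * c * Real.exp (l * (t - s))) * Real.exp (-(l - ω) * (t - τ)) := by
    refine intervalIntegral.norm_integral_le_of_norm_le hst ?_
      (Continuous.intervalIntegrable (by fun_prop) _ _)
    have hD' := ae_restrict_of_ae_restrict_of_subset
      (show Ioc s t ⊆ Ici 0 from fun τ hτ => hs.trans hτ.1.le) hD
    rw [ae_restrict_iff' measurableSet_Ioc] at hD'
    filter_upwards [hD'] with τ hτ hmem
    calc ‖𝒰.U t τ (D τ (v τ))‖
        ≤ (M * Real.exp (ω * (t - τ))) * (K * (c * Real.exp (l * (τ - s)))) := by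
          refine (𝒰.U t τ).le_of_opNorm_le_of_le (hU τ t (hs.trans hmem.1.le) hmem.2) ?_
          exact (D τ).le_of_opNorm_le_of_le (hτ hmem) (hv τ hmem.1.le hmem.2)
      _ = (M * K * c) * (Real.exp (ω * (t - τ)) * Real.exp (l * (τ - s))) := by ring
      _ = (M * K * c) * (Real.exp (l * (t - s)) * Real.exp (-(l - ω) * (t - τ))) := by
          rw [← Real.exp_add, ← Real.exp_add]
          congr 2
          ring
      _ = _ := by ring
  refine b.trans ?_
  rw [intervalIntegral.integral_const_mul]
  calc _ ≤ (M * K * c * Real.exp (l * (t - s))) * (l - ω)⁻¹ := by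
        gcongr
        exact integral_exp_neg_sub_le hδ s t
    _ = _ := by rw [div_eq_mul_inv]; ring

theorem eq_zero_of_volterra (h : 𝒰.ExpBounded) (hK : 0 ≤ K) (hD : ∀ᵐ τ ∂halfLine, ‖D τ‖ ≤ K)
    {s : ℝ} (hs : 0 ≤ s) {v : ℝ → X} {c a : ℝ}
    (hb : ∀ t, s ≤ t → ‖v t‖ ≤ c * Real.exp (a * (t - s)))
    (hv : ∀ t, s ≤ t → v t = ∫ τ in s..t, 𝒰.U t τ (D τ (v τ))) {t : ℝ} (ht : s ≤ t) :
    v t = 0 := by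
  obtain ⟨M, ω, hM, hU⟩ := h
  have hM0 : 0 ≤ M := by linarith
  have hMK : 0 ≤ M * K := mul_nonneg hM0 hK
  -- `l ≥ a` keeps the growth bound on `v`; the other term forces the contraction factor `M * K / (l
  -- - ω)` below `1/2`, with `+ 1` keeping `l - ω` positive when `M * K = 0`. Iterating the equation
  -- then sends `v` to zero.
  set l := max a (ω + 2 * (M * K) + 1)
  have hl : ω + 2 * (M * K) + 1 ≤ l := le_max_right _ _
  have hc : 0 ≤ c := by
    have := (norm_nonneg _).trans (hb s le_rfl)
    simpa using this
  have step : ∀ n : ℕ, ∀ t, s ≤ t → ‖v t‖ ≤ ((1 / 2) ^ n * c) * Real.exp (l * (t - s)) := by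
    intro n
    induction n with
    | zero =>
      intro t ht
      rw [pow_zero, one_mul]
      refine (hb t ht).trans ?_
      have : 0 ≤ t - s := sub_nonneg.2 ht
      gcongr
      exact le_max_left _ _
    | succ n ih =>
      intro t ht
      rw [hv t ht]
      refine (norm_volterra_integral_le hM0 hU hK hD (l := l) (by linarith) hs ht
        (by positivity) fun τ h1 _ => ih τ h1).trans ?_
      rw [pow_succ' (1 / 2 : ℝ) n]
      have hq : M * K / (l - ω) ≤ 1 / 2 := by
        rw [div_le_iff₀ (by linarith)]
        linarith
      exact mul_le_mul_of_nonneg_right ((mul_le_mul_of_nonneg_right hq (by positivity)).trans_eq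
        (by ring)) (Real.exp_pos _).le
  have lim : Tendsto (fun n : ℕ => ((1 / 2 : ℝ) ^ n * c) * Real.exp (l * (t - s))) atTop (𝓝 0) := by
    have := ((tendsto_pow_atTop_nhds_zero_of_lt_one (r := (1 / 2 : ℝ)) (by norm_num)
      (by norm_num)).mul_const c).mul_const (Real.exp (l * (t - s)))
    simpa using this
  exact norm_le_zero_iff.1 (ge_of_tendsto' lim fun n => step n t ht)

/-! ### Existence of the perturbed evolution family -/

/-- The closed triangle `{(t, s) | t ≥ s ≥ 0}`. -/
abbrev Triangle : Type := {q : ℝ × ℝ // 0 ≤ q.2 ∧ q.2 ≤ q.1}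

/-- A continuous retraction of the plane onto the triangle. -/
noncomputable def toTriangle (t s : ℝ) : Triangle :=
  ⟨(max t (max s 0), max s 0), le_max_right _ _, le_max_right _ _⟩

theorem toTriangle_eq {t s : ℝ} (hs : 0 ≤ s) (hst : s ≤ t) : toTriangle t s = ⟨(t, s), hs, hst⟩ := by
  simp [toTriangle, max_eq_left hs, max_eq_left hst]

theorem continuous_toTriangle : Continuous fun q : ℝ × ℝ => toTriangle q.1 q.2 :=
  Continuous.subtype_mk (by fun_prop) _

open scoped BoundedContinuousFunction

theorem aestronglyMeasurable_op_apply (D : StrongLinfty X X) {v : ℝ → X} (hv : Continuous v) :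
    AEStronglyMeasurable (fun τ => D.op τ (v τ)) halfLine :=
  aestronglyMeasurable_strong_apply D.strongly_meas hv.aestronglyMeasurable

theorem ExpBounded.intervalIntegrable_volterra (h : 𝒰.ExpBounded) (D : StrongLinfty X X)
    {v : ℝ → X} (hv : Continuous v) {s t t' : ℝ} (hs : 0 ≤ s) (hst : s ≤ t) (htt' : t ≤ t') :
    IntervalIntegrable (fun τ => 𝒰.U t' τ (D.op τ (v τ))) volume s t := by
  have hi : IntegrableOn (fun τ => D.op τ (v τ)) (Ioc s t') := by
    refine Integrable.mono' (g := fun τ => D.essNorm.toReal * ‖v τ‖)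
      ((Continuous.integrableOn_Icc (by fun_prop)).mono_set Ioc_subset_Icc_self)
      ((aestronglyMeasurable_op_apply D hv).mono_measure
        (Measure.restrict_mono (fun τ hτ => hs.trans hτ.1.le) le_rfl)) ?_
    exact ae_restrict_of_ae_restrict_of_subset
      (show Ioc s t' ⊆ Ici 0 from fun τ hτ => hs.trans hτ.1.le) (D.ae_norm_le v)
  refine (h.intervalIntegrable_apply hs (hst.trans htt') (aestronglyMeasurable_op_apply D hv)
    hi).mono_set ?_
  rw [uIcc_of_le hst, uIcc_of_le (hst.trans htt')]
  exact Icc_subset_Icc_right htt'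

theorem continuous_volterra (h : 𝒰.ExpBounded) (D : StrongLinfty X X) (Ψ : Triangle →ᵇ X) :
    Continuous fun q : Triangle =>
      ∫ τ in q.1.2..q.1.1, 𝒰.U q.1.1 τ (D.op τ (Ψ (toTriangle τ q.1.2))) := by
  have H := h.continuousOn_integral (g := fun s τ => D.op τ (Ψ (toTriangle τ s)))
    (b := fun _ => D.essNorm.toReal * ‖Ψ‖)
    (fun s => aestronglyMeasurable_op_apply D (Ψ.continuous.comp
      (continuous_toTriangle.comp (f := fun τ : ℝ => (τ, s)) (by fun_prop))))
    (Eventually.of_forall fun τ => (D.op τ).continuous.comp (Ψ.continuous.comp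
      (continuous_toTriangle.comp (f := fun s : ℝ => (τ, s)) (by fun_prop))))
    (fun s => by
      filter_upwards [D.ae_norm_le fun τ => Ψ (toTriangle τ s)] with τ hτ
      refine hτ.trans ?_
      gcongr
      exact Ψ.norm_coe_le_norm _)
    (fun T => integrableOn_const (by simp))
  exact continuousOn_iff_continuous_domRestrict.1 H

theorem norm_volterra_le (hM : 0 ≤ M) (hω : ω < 0)
    (hU : ∀ τ t, 0 ≤ τ → τ ≤ t → ‖𝒰.U t τ‖ ≤ M * Real.exp (ω * (t - τ)))
    (D : StrongLinfty X X) (Ψ : Triangle →ᵇ X) (q : Triangle) :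
    ‖∫ τ in q.1.2..q.1.1, 𝒰.U q.1.1 τ (D.op τ (Ψ (toTriangle τ q.1.2)))‖
      ≤ M * D.essNorm.toReal / (-ω) * ‖Ψ‖ := by
  have := norm_volterra_integral_le hM hU ENNReal.toReal_nonneg D.ae_norm_op_le hω q.2.1 q.2.2
    (v := fun τ => Ψ (toTriangle τ q.1.2)) (norm_nonneg Ψ) (fun τ _ _ => by
      rw [zero_mul, Real.exp_zero, mul_one]
      exact Ψ.norm_coe_le_norm _)
  simpa using this

/-- The Volterra operator on bounded continuous functions on the triangle. -/
noncomputable def volterraOp (hM : 0 ≤ M) (hω : ω < 0)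
    (hU : ∀ τ t, 0 ≤ τ → τ ≤ t → ‖𝒰.U t τ‖ ≤ M * Real.exp (ω * (t - τ)))
    (h : 𝒰.ExpBounded) (D : StrongLinfty X X) : (Triangle →ᵇ X) →L[ℂ] (Triangle →ᵇ X) :=
  LinearMap.mkContinuous
    { toFun := fun Ψ => BoundedContinuousFunction.ofNormedAddCommGroup _
        (continuous_volterra h D Ψ) _ (norm_volterra_le hM hω hU D Ψ)
      map_add' := fun Ψ Θ => by
        ext q
        have i : ∀ Ψ : Triangle →ᵇ X, IntervalIntegrable
            (fun τ => 𝒰.U q.1.1 τ (D.op τ (Ψ (toTriangle τ q.1.2)))) volume q.1.2 q.1.1 :=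
          fun Ψ => h.intervalIntegrable_volterra D (Ψ.continuous.comp
            (continuous_toTriangle.comp (f := fun τ : ℝ => (τ, q.1.2)) (by fun_prop)))
            q.2.1 q.2.2 le_rfl
        simp only [BoundedContinuousFunction.coe_ofNormedAddCommGroup,
          BoundedContinuousFunction.coe_add, Pi.add_apply, map_add]
        exact intervalIntegral.integral_add (i Ψ) (i Θ)
      map_smul' := fun c Ψ => by
        ext q
        simp only [BoundedContinuousFunction.coe_ofNormedAddCommGroup,
          BoundedContinuousFunction.coe_smul, map_smul, RingHom.id_apply]
        exact intervalIntegral.integral_smul c _ }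
    (M * D.essNorm.toReal / (-ω))
    (fun Ψ => BoundedContinuousFunction.norm_ofNormedAddCommGroup_le _
      (mul_nonneg (div_nonneg (mul_nonneg hM ENNReal.toReal_nonneg) (by linarith))
        (norm_nonneg _)) (norm_volterra_le hM hω hU D Ψ))

theorem norm_volterraOp_le (hM : 0 ≤ M) (hω : ω < 0)
    (hU : ∀ τ t, 0 ≤ τ → τ ≤ t → ‖𝒰.U t τ‖ ≤ M * Real.exp (ω * (t - τ)))
    (h : 𝒰.ExpBounded) (D : StrongLinfty X X) :
    ‖volterraOp hM hω hU h D‖ ≤ M * D.essNorm.toReal / (-ω) := by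
  have h0 : 0 ≤ M * D.essNorm.toReal / (-ω) :=
    div_nonneg (mul_nonneg hM ENNReal.toReal_nonneg) (by linarith)
  exact ContinuousLinearMap.opNorm_le_bound _ h0 fun Ψ =>
    (BoundedContinuousFunction.norm_le (mul_nonneg h0 (norm_nonneg _))).2
      (norm_volterra_le hM hω hU D Ψ)

/-- The bounded continuous function `(t, s) ↦ U(t, s) x` for a bounded evolution family. -/
noncomputable def orbit (hU : ∀ τ t, 0 ≤ τ → τ ≤ t → ‖𝒰.U t τ‖ ≤ M) (x : X) : Triangle →ᵇ X :=
  BoundedContinuousFunction.ofNormedAddCommGroup (fun q : Triangle => 𝒰.U q.1.1 q.1.2 x)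
    (continuousOn_iff_continuous_domRestrict.1 (𝒰.strong_cont x)) (M * ‖x‖)
    (fun q => (𝒰.U q.1.1 q.1.2).le_of_opNorm_le (hU _ _ q.2.1 q.2.2) x)

theorem orbit_apply (hU : ∀ τ t, 0 ≤ τ → τ ≤ t → ‖𝒰.U t τ‖ ≤ M) (x : X) (q : Triangle) :
    orbit hU x q = 𝒰.U q.1.1 q.1.2 x := rfl

/-- The map `x ↦ ((t, s) ↦ U(t, s) x)` for a bounded evolution family. -/
noncomputable def orbitOp (hM : 0 ≤ M) (hU : ∀ τ t, 0 ≤ τ → τ ≤ t → ‖𝒰.U t τ‖ ≤ M) :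
    X →L[ℂ] (Triangle →ᵇ X) :=
  LinearMap.mkContinuous
    { toFun := orbit hU
      map_add' := fun x y => by
        ext q
        rw [BoundedContinuousFunction.add_apply]
        simp only [orbit_apply, map_add]
      map_smul' := fun c x => by
        ext q
        rw [BoundedContinuousFunction.smul_apply]
        simp only [orbit_apply, map_smul, RingHom.id_apply] }
    M
    (fun x => (BoundedContinuousFunction.norm_le (mul_nonneg hM (norm_nonneg _))).2
      fun q => (𝒰.U q.1.1 q.1.2).le_of_opNorm_le (hU _ _ q.2.1 q.2.2) x)

variable [CompleteSpace X]

/-- A bounded, jointly strongly continuous solution of the Volterra equation is an evolution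
family. -/
theorem exists_evolutionFamily_of_volterra (h : 𝒰.ExpBounded) (D : StrongLinfty X X)
    {W : ℝ → ℝ → X →L[ℂ] X} (hcont : ∀ x, Continuous fun q : ℝ × ℝ => W q.1 q.2 x) {N : ℝ}
    (hN : ∀ t s, ‖W t s‖ ≤ N)
    (hW : ∀ s t, 0 ≤ s → s ≤ t → ∀ x, W t s x =
      𝒰.U t s x + ∫ τ in s..t, 𝒰.U t τ (D.op τ (W τ s x))) :
    ∃ 𝒲 : EvolutionFamily X, 𝒲.U = W := by
  refine ⟨⟨W, ?_, ?_, fun x => (hcont x).continuousOn⟩, rfl⟩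
  · intro τ s t h0 h1 h2
    ext x
    rw [ContinuousLinearMap.comp_apply, ← sub_eq_zero]
    have hs : 0 ≤ s := h0.trans h1
    have cW : ∀ σ y, Continuous fun r => W r σ y := fun σ y =>
      (hcont y).comp (f := fun r : ℝ => (r, σ)) (by fun_prop)
    -- From time `s` on, `W(·, τ)x` and `W(·, s)W(s, τ)x` solve the same equation with the same
    -- initial vector, so their bounded difference solves the homogeneous equation.
    refine eq_zero_of_volterra h ENNReal.toReal_nonneg D.ae_norm_op_le hs
      (v := fun t => W t τ x - W t s (W s τ x)) (c := N * ‖x‖ + N * ‖W s τ x‖) (a := 0)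
      (fun t _ => ?_) (fun t ht => ?_) h2
    · rw [zero_mul, Real.exp_zero, mul_one]
      exact (norm_sub_le _ _).trans (add_le_add ((W t τ).le_of_opNorm_le (hN t τ) x)
        ((W t s).le_of_opNorm_le (hN t s) _))
    · have i1 := h.intervalIntegrable_volterra D (cW τ x) h0 h1 ht
      have i2 := h.intervalIntegrable_volterra D (cW τ x) hs ht le_rfl
      have i3 := h.intervalIntegrable_volterra D (cW s (W s τ x)) hs ht le_rfl
      -- Restarting the equation at `s`: the integral splits there, and `U(t, s)` factors out of the
      -- earlier part.
      have e1 : W t τ x = 𝒰.U t s (W s τ x) + ∫ r in s..t, 𝒰.U t r (D.op r (W r τ x)) := by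
        rw [hW τ t h0 (h1.trans ht) x, hW τ s h0 h1 x, map_add,
          ← intervalIntegral.integral_add_adjacent_intervals i1 i2, ← add_assoc,
          𝒰.comp τ s t h0 h1 ht, ContinuousLinearMap.comp_apply,
          ← ContinuousLinearMap.intervalIntegral_comp_comm _
            (h.intervalIntegrable_volterra D (cW τ x) h0 h1 le_rfl)]
        congr 2
        refine intervalIntegral.integral_congr fun r hr => ?_
        rw [uIcc_of_le h1] at hr
        simp only [𝒰.comp r s t (h0.trans hr.1) hr.2 ht, ContinuousLinearMap.comp_apply]
      rw [e1, hW s t hs ht (W s τ x), add_sub_add_left_eq_sub,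
        ← intervalIntegral.integral_sub i2 i3]
      simp only [map_sub]
  · intro t ht
    ext x
    rw [hW t t ht le_rfl x, intervalIntegral.integral_same, add_zero, 𝒰.self t ht]

/-- On bounded continuous functions on the triangle the Volterra operator `K` has norm below one, so
`1 - K` is invertible. Applying its inverse to `(t, s) ↦ U(t, s)x` gives the solution, with joint
continuity and boundedness built in. -/
theorem exists_volterraSolution_of_small (hM : 0 ≤ M) (hω : ω < 0)
    (hU : ∀ τ t, 0 ≤ τ → τ ≤ t → ‖𝒰.U t τ‖ ≤ M * Real.exp (ω * (t - τ)))
    (h : 𝒰.ExpBounded) (D : StrongLinfty X X) (hsmall : M * D.essNorm.toReal / (-ω) < 1) :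
    ∃ 𝒲 : EvolutionFamily X, 𝒲.ExpBounded ∧ 𝒰.IsVolterraSolution D.op 𝒲 := by
  have hU1 : ∀ τ t, 0 ≤ τ → τ ≤ t → ‖𝒰.U t τ‖ ≤ M := fun τ t h0 h1 =>
    (hU τ t h0 h1).trans (mul_le_of_le_one_right hM (Real.exp_le_one_iff.2
      (mul_nonpos_of_nonpos_of_nonneg hω.le (sub_nonneg.2 h1))))
  set K := volterraOp hM hω hU h D
  have hK1 : ‖K‖ < 1 := lt_of_le_of_lt (norm_volterraOp_le hM hω hU h D) hsmall
  obtain ⟨u, hu⟩ := isUnit_one_sub_of_norm_lt_one hK1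
  set R : (Triangle →ᵇ X) →L[ℂ] (Triangle →ᵇ X) := ↑u⁻¹
  have hR : ∀ Ψ, R Ψ = Ψ + K (R Ψ) := by
    intro Ψ
    have e : (1 - K) * R = 1 := by rw [← hu]; exact u.mul_inv
    have := DFunLike.congr_fun e Ψ
    simp only [mul_apply_eq_comp, sub_apply, one_apply_eq_self] at this
    exact sub_eq_iff_eq_add.1 this
  set F := orbitOp hM hU1
  set W : ℝ → ℝ → X →L[ℂ] X := fun t s =>
    (BoundedContinuousFunction.evalCLM ℂ (toTriangle t s)) ∘L R ∘L F
  have hWapp : ∀ t s x, W t s x = R (F x) (toTriangle t s) := fun _ _ _ => rfl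
  have hN : ∀ t s, ‖W t s‖ ≤ ‖R ∘L F‖ := fun t s =>
    ContinuousLinearMap.opNorm_le_bound _ (norm_nonneg _) fun x =>
      ((R (F x)).norm_coe_le_norm _).trans ((R ∘L F).le_opNorm x)
  have hW : ∀ s t, 0 ≤ s → s ≤ t → ∀ x, W t s x =
      𝒰.U t s x + ∫ τ in s..t, 𝒰.U t τ (D.op τ (W τ s x)) := by
    intro s t h0 h1 x
    rw [hWapp, hR, BoundedContinuousFunction.add_apply, toTriangle_eq h0 h1]
    rfl
  obtain ⟨𝒲, h𝒲⟩ := exists_evolutionFamily_of_volterra h D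
    (fun x => (R (F x)).continuous.comp continuous_toTriangle) hN hW
  refine ⟨𝒲, ⟨max 1 ‖R ∘L F‖, 0, le_max_left _ _, fun τ t _ _ => ?_⟩, ?_⟩
  swap
  · rw [← h𝒲] at hW
    exact hW
  rw [h𝒲, zero_mul, Real.exp_zero, mul_one]
  exact (hN t τ).trans (le_max_right _ _)

theorem ExpBounded.exists_volterraSolution (h : 𝒰.ExpBounded) (D : StrongLinfty X X) :
    ∃ 𝒲 : EvolutionFamily X, 𝒲.ExpBounded ∧ 𝒰.IsVolterraSolution D.op 𝒲 := by
  obtain ⟨M, ω, hM, hU⟩ := id h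
  have hMK : 0 ≤ M * D.essNorm.toReal := mul_nonneg (by linarith) ENNReal.toReal_nonneg
  -- Rescaling by `e^{-l(t-s)}` leaves decay rate `M‖D‖_∞ + 1`, hence contraction ratio `M‖D‖_∞ /
  -- (M‖D‖_∞ + 1) < 1`.
  set l : ℝ := ω + (M * D.essNorm.toReal + 1)
  have hre : ω + (-(l : ℂ)).re = -(M * D.essNorm.toReal + 1) := by simp [l]
  have hU' := norm_rescale_le hU (-(l : ℂ))
  rw [hre] at hU'
  obtain ⟨𝒲, hb, hs⟩ := exists_volterraSolution_of_small (by linarith) (by linarith) hU'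
    (h.rescale _) D (by
      rw [neg_neg, div_lt_one (by linarith)]
      linarith)
  refine ⟨𝒲.rescale (l : ℂ), hb.rescale _, ?_⟩
  have := hs.rescale (l : ℂ)
  have e := 𝒰.rescale_rescale_neg (-(l : ℂ))
  rw [neg_neg] at e
  rwa [e] at this

end EvolutionFamily

namespace EvolutionFamily

variable {X : Type*} [NormedAddCommGroup X] [NormedSpace ℂ X] {𝒲 : EvolutionFamily X}
  {p : ℝ≥0∞}

/-! ### Datko's criterion -/

theorem norm_le_half_pow {T₀ : ℝ} (hT : 0 ≤ T₀)
    (h : ∀ s, 0 ≤ s → ‖𝒲.U (s + T₀) s‖ ≤ 1 / 2) (n : ℕ) {s : ℝ} (hs : 0 ≤ s) :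
    ‖𝒲.U (s + n * T₀) s‖ ≤ (1 / 2) ^ n := by
  induction n with
  | zero =>
    rw [Nat.cast_zero, zero_mul, add_zero, 𝒲.self s hs, pow_zero]
    exact ContinuousLinearMap.norm_id_le
  | succ n ih =>
    have hn : 0 ≤ n * T₀ := by positivity
    have e : s + (n + 1 : ℕ) * T₀ = s + n * T₀ + T₀ := by push_cast; ring
    rw [e, 𝒲.comp s (s + n * T₀) _ hs (by linarith) (by linarith), pow_succ']
    exact (ContinuousLinearMap.opNorm_comp_le _ _).trans
      (mul_le_mul (h _ (by linarith)) ih (norm_nonneg _) (by norm_num))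

theorem expStable_of_norm_le_half {N T₀ : ℝ} (hN1 : 1 ≤ N) (hT : 0 < T₀)
    (hN : ∀ s t, 0 ≤ s → s ≤ t → ‖𝒲.U t s‖ ≤ N)
    (h : ∀ s, 0 ≤ s → ‖𝒲.U (s + T₀) s‖ ≤ 1 / 2) : 𝒲.ExpStable := by
  have hlog : 0 < Real.log 2 := Real.log_pos (by norm_num)
  -- Halving over each period `T₀` gives the rate `log 2 / T₀`; the factor `2` pays for rounding `(t
  -- - s) / T₀` down.
  refine ⟨2 * N, -(Real.log 2 / T₀), by linarith, neg_lt_zero.2 (by positivity),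
    fun s t hs hst => ?_⟩
  set n := ⌊(t - s) / T₀⌋₊
  have h0 : 0 ≤ (t - s) / T₀ := div_nonneg (sub_nonneg.2 hst) hT.le
  have hn1 : n * T₀ ≤ t - s := (le_div_iff₀ hT).1 (Nat.floor_le h0)
  have hn2 : (t - s) / T₀ < n + 1 := Nat.lt_floor_add_one _
  have hn0 : 0 ≤ n * T₀ := by positivity
  have hpow : (1 / 2 : ℝ) ^ n ≤ 2 * Real.exp (-(Real.log 2 / T₀) * (t - s)) := by
    have e1 : (1 / 2 : ℝ) ^ n = Real.exp (-(n * Real.log 2)) := by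
      rw [Real.exp_neg, Real.exp_nat_mul, Real.exp_log (by norm_num), one_div, inv_pow]
    have e2 : 2 * Real.exp (-(Real.log 2 / T₀) * (t - s))
        = Real.exp (Real.log 2 + -(Real.log 2 / T₀) * (t - s)) := by
      rw [Real.exp_add, Real.exp_log (by norm_num)]
    rw [e1, e2, Real.exp_le_exp]
    have : (t - s) / T₀ * Real.log 2 ≤ (n + 1) * Real.log 2 := by gcongr
    have e3 : -(Real.log 2 / T₀) * (t - s) = -((t - s) / T₀ * Real.log 2) := by ring
    rw [e3]
    linarith
  rw [𝒲.comp s (s + n * T₀) t hs (by linarith) (by linarith)]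
  calc _ ≤ N * (1 / 2) ^ n := (ContinuousLinearMap.opNorm_comp_le _ _).trans
        (mul_le_mul (hN _ _ (by linarith) (by linarith)) (norm_le_half_pow hT.le h n hs)
          (norm_nonneg _) (by linarith))
    _ ≤ N * (2 * Real.exp (-(Real.log 2 / T₀) * (t - s))) := by gcongr
    _ = _ := by ring

theorem mul_rpow_le_of_eLpNorm_indicator_le {E : Type*} [NormedAddCommGroup E] (hp0 : p ≠ 0)
    (hp : p ≠ ∞) {v : ℝ → E}
    {s T a b m C : ℝ} (hs : 0 ≤ s) (ha : s ≤ a) (hab : a ≤ b) (hb : b ≤ T) (hm : 0 ≤ m)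
    (hC : 0 ≤ C) (hv : ∀ t, a ≤ t → t ≤ b → m ≤ ‖v t‖)
    (h : eLpNorm ((Icc s T).indicator v) p halfLine ≤ ENNReal.ofReal C) :
    m * (b - a) ^ (1 / p.toReal) ≤ C := by
  have h1 : eLpNorm ((Icc a b).indicator fun _ => m) p halfLine ≤ ENNReal.ofReal C := by
    refine le_trans (eLpNorm_mono fun t => ?_) h
    by_cases ht : t ∈ Icc a b
    · rw [indicator_of_mem ht, indicator_of_mem
        (show t ∈ Icc s T from ⟨ha.trans ht.1, ht.2.trans hb⟩), Real.norm_of_nonneg hm]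
      exact hv t ht.1 ht.2
    · rw [indicator_of_notMem ht, norm_zero]
      exact norm_nonneg _
  rw [eLpNorm_indicator_const measurableSet_Icc hp0 hp, Measure.restrict_apply measurableSet_Icc,
    inter_eq_left.2 (show Icc a b ⊆ Ici 0 from fun t ht => hs.trans (ha.trans ht.1)),
    Real.volume_Icc, Real.enorm_of_nonneg hm,
    ENNReal.ofReal_rpow_of_nonneg (sub_nonneg.2 hab) (by positivity),
    ← ENNReal.ofReal_mul hm] at h1
  exact (ENNReal.ofReal_le_ofReal_iff hC).1 h1

/-- **Datko's theorem**: an exponentially bounded evolution family with uniformly `L^p`-bounded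
orbits is exponentially stable. -/
theorem expStable_of_eLpNorm_le (h : 𝒲.ExpBounded) (hp0 : p ≠ 0) (hp : p ≠ ∞) {c : ℝ}
    (hc : 0 ≤ c) (H : ∀ s T x, 0 ≤ s → s ≤ T →
      eLpNorm ((Icc s T).indicator fun t => 𝒲.U t s x) p halfLine ≤ ENNReal.ofReal (c * ‖x‖)) :
    𝒲.ExpStable := by
  obtain ⟨M, ω, hM, hU⟩ := h
  have hpr : 0 < p.toReal := ENNReal.toReal_pos hp0 hp
  set k := M * Real.exp |ω| with hk
  have hk1 : 1 ≤ k := by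
    have := Real.one_le_exp (abs_nonneg ω)
    nlinarith
  have short : ∀ τ t, 0 ≤ τ → τ ≤ t → t ≤ τ + 1 → ‖𝒲.U t τ‖ ≤ k := by
    intro τ t h0 h1 h2
    refine (hU τ t h0 h1).trans ?_
    rw [hk]
    gcongr M * Real.exp ?_
    have h3 : ω * (t - τ) ≤ |ω| * (t - τ) :=
      mul_le_mul_of_nonneg_right (le_abs_self ω) (sub_nonneg.2 h1)
    exact h3.trans (mul_le_of_le_one_right (abs_nonneg _) (by linarith))
  -- A large value at time `t` forces large values earlier: this turns `L^p` bounds on the orbit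
  -- into pointwise ones.
  have pull : ∀ {K : ℝ}, 0 < K → ∀ {s τ t : ℝ} (x : X), 0 ≤ s → s ≤ τ → τ ≤ t → ‖𝒲.U t τ‖ ≤ K →
      K⁻¹ * ‖𝒲.U t s x‖ ≤ ‖𝒲.U τ s x‖ := by
    intro K hK s τ t x h0 h1 h2 h3
    rw [inv_mul_le_iff₀ hK, 𝒲.comp s τ t h0 h1 h2, ContinuousLinearMap.comp_apply]
    exact (𝒲.U t τ).le_of_opNorm_le h3 _
  -- Times within one unit of `s` cost `k`; later, the `L^p` bound on `[t - 1, t]` gives `k * c`.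
  set N := k * (1 + c) with hNdef
  have hN1 : 1 ≤ N := by nlinarith
  have hN : ∀ s t, 0 ≤ s → s ≤ t → ‖𝒲.U t s‖ ≤ N := by
    intro s t hs hst
    rcases le_total t (s + 1) with h1 | h1
    · exact (short s t hs hst h1).trans (by nlinarith)
    · refine ContinuousLinearMap.opNorm_le_bound _ (by linarith) fun x => ?_
      have := mul_rpow_le_of_eLpNorm_indicator_le hp0 hp (a := t - 1) (b := t)
        (m := k⁻¹ * ‖𝒲.U t s x‖) hs (by linarith) (by linarith) le_rfl (by positivity)
        (by positivity) (fun τ h2 h3 => pull (by linarith) x hs (by linarith) h3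
          (short τ t (by linarith) h3 (by linarith))) (H s t x hs hst)
      rw [sub_sub_cancel, Real.one_rpow, mul_one, inv_mul_le_iff₀ (by linarith)] at this
      refine this.trans ?_
      rw [hNdef, ← mul_assoc]
      refine mul_le_mul_of_nonneg_right ?_ (norm_nonneg x)
      nlinarith
  -- On `[s, s + T₀]` the orbit is at least `N⁻¹` times its final norm, so that norm is at most `N c
  -- T₀^{-1/p} ‖x‖`, and `N c / (2 N c + 1) ≤ 1/2`. The `+ 1` keeps `T₀` positive if `c = 0`.
  set T₀ := (2 * N * c + 1) ^ p.toReal with hT₀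
  have hNc : 0 ≤ N * c := mul_nonneg (by linarith) hc
  have hT₀pos : 0 < T₀ := Real.rpow_pos_of_pos (by nlinarith) _
  refine expStable_of_norm_le_half hN1 hT₀pos hN fun s hs => ?_
  refine ContinuousLinearMap.opNorm_le_bound _ (by norm_num) fun x => ?_
  have := mul_rpow_le_of_eLpNorm_indicator_le hp0 hp (a := s) (b := s + T₀)
    (m := N⁻¹ * ‖𝒲.U (s + T₀) s x‖) hs le_rfl (by linarith) le_rfl (by positivity)
    (by positivity) (fun τ h2 h3 => pull (by linarith) x hs (by linarith) h3
      (hN τ _ (by linarith) h3)) (H s (s + T₀) x hs (by linarith))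
  rw [add_sub_cancel_left, hT₀, ← Real.rpow_mul (by linarith), mul_one_div_cancel hpr.ne',
    Real.rpow_one, ← hT₀, mul_assoc, inv_mul_le_iff₀ (by linarith)] at this
  have hx := norm_nonneg (𝒲.U (s + T₀) s x)
  have hpos : 0 < 2 * N * c + 1 := by linarith
  rw [← le_div_iff₀ hpos] at this
  refine this.trans ?_
  rw [div_le_iff₀ hpos]
  nlinarith [norm_nonneg x]

end EvolutionFamily

/-! ### Estimates for multiplication operators -/

namespace StrongLinfty

variable {E F : Type*} [NormedAddCommGroup E] [NormedSpace ℂ E]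
  [NormedAddCommGroup F] [NormedSpace ℂ F] {p : ℝ≥0∞} [Fact (1 ≤ p)]

theorem coeFn_mulOp (D : StrongLinfty E F) (f : Lp E p halfLine) :
    D.mulOp p f =ᵐ[halfLine] fun t => D.op t (f t) :=
  (D.memLp f).coeFn_toLp

theorem norm_mulOp_le (D : StrongLinfty E F) : ‖D.mulOp p‖ ≤ D.essNorm.toReal :=
  LinearMap.mkContinuous_norm_le _ ENNReal.toReal_nonneg _

end StrongLinfty

namespace EvolutionFamily

/-! ### Robustness of exponential stability -/

theorem memLp_exp {p : ℝ≥0∞} (hp0 : p ≠ 0) (hp : p ≠ ∞) {ω : ℝ} (hω : ω < 0) :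
    MemLp (fun r => Real.exp (ω * r)) p halfLine := by
  have hpr : 0 < p.toReal := ENNReal.toReal_pos hp0 hp
  rw [← integrable_norm_rpow_iff (Continuous.aestronglyMeasurable (by fun_prop)) hp0 hp]
  have e : (fun r => ‖Real.exp (ω * r)‖ ^ p.toReal) = fun r => Real.exp ((ω * p.toReal) * r) := by
    funext r
    rw [Real.norm_of_nonneg (Real.exp_pos _).le, ← Real.exp_mul]
    congr 1
    ring
  rw [e]
  exact (integrableOn_Ici_iff_integrableOn_Ioi (by simp)).2
    (integrableOn_exp_mul_Ioi (mul_neg_of_neg_of_pos hω hpr) 0)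

variable {X : Type*} [NormedAddCommGroup X] [NormedSpace ℂ X] {𝒰 𝒲 : EvolutionFamily X}
  {p : ℝ≥0∞}

theorem continuousOn_orbit (𝒰 : EvolutionFamily X) {s : ℝ} (hs : 0 ≤ s) (x : X) :
    ContinuousOn (fun t => 𝒰.U t s x) (Ici s) :=
  (𝒰.strong_cont x).comp (f := fun t : ℝ => (t, s)) (by fun_prop) fun _ ht => ⟨hs, ht⟩

theorem halfLine_restrict_Icc {s : ℝ} (hs : 0 ≤ s) (T : ℝ) :
    halfLine.restrict (Icc s T) = volume.restrict (Icc s T) := by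
  rw [Measure.restrict_restrict measurableSet_Icc,
    inter_eq_left.2 (show Icc s T ⊆ Ici 0 from fun τ hτ => hs.trans hτ.1)]

/-- Cutting off at `T` puts the orbit in `L^p` before any decay of `𝒲` is known, so its norm can be
absorbed in the small-gain estimate. -/
theorem memLp_indicator_orbit (𝒲 : EvolutionFamily X) {s : ℝ} (hs : 0 ≤ s) (T : ℝ) (x : X) :
    MemLp ((Icc s T).indicator fun t => 𝒲.U t s x) p halfLine := by
  rw [memLp_indicator_iff_restrict measurableSet_Icc, halfLine_restrict_Icc hs]
  have hc := (𝒲.continuousOn_orbit hs x).mono (show Icc s T ⊆ Ici s from fun _ ht => ht.1)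
  obtain ⟨C, hC⟩ := isCompact_Icc.exists_bound_of_continuousOn hc
  refine MemLp.of_bound (hc.aestronglyMeasurable measurableSet_Icc) C ?_
  filter_upwards [ae_restrict_mem measurableSet_Icc] with t ht
  exact hC t ht

/-- The orbit is dominated by an exponential translated by `s`. Translation preserves the norm, so
the constant is uniform in `s`, as Datko's theorem needs. -/
theorem ExpStable.exists_eLpNorm_orbit_le (h : 𝒰.ExpStable) (hp0 : p ≠ 0) (hp : p ≠ ∞) :
    ∃ c : ℝ≥0, ∀ s x, 0 ≤ s →
      eLpNorm ((Ici s).indicator fun t => 𝒰.U t s x) p halfLine ≤ c * ‖x‖ₑ := by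
  obtain ⟨M, ω, hM, hω, hU⟩ := h
  have hE := memLp_exp hp0 hp hω
  refine ⟨M.toNNReal * (eLpNorm (fun r => Real.exp (ω * r)) p halfLine).toNNReal,
    fun s x hs => ?_⟩
  rw [ENNReal.coe_mul, ENNReal.coe_toNNReal hE.2.ne,
    eLpNorm_indicator_eq_eLpNorm_restrict measurableSet_Ici, halfLine_restrict hs,
    ← eLpNorm_comp_measurePreserving hE.1 (measurePreserving_shift s), mul_right_comm]
  have e : (M.toNNReal : ℝ≥0∞) * ‖x‖ₑ = ((M.toNNReal * ‖x‖₊ : ℝ≥0) : ℝ≥0∞) := by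
    rw [ENNReal.coe_mul]
    rfl
  rw [e]
  refine eLpNorm_le_nnreal_smul_eLpNorm_of_ae_le_mul ?_ p
  filter_upwards [ae_restrict_mem measurableSet_Ici] with t ht
  rw [← NNReal.coe_le_coe]
  simp only [NNReal.coe_mul, coe_nnnorm, Function.comp_apply, Real.coe_toNNReal M (by linarith),
    Real.norm_of_nonneg (Real.exp_pos _).le]
  refine ((𝒰.U t s).le_of_opNorm_le (hU s t hs ht) x).trans_eq (by ring)

theorem ExpStable.memLp_orbit (h : 𝒰.ExpStable) (hp0 : p ≠ 0) (hp : p ≠ ∞) {s : ℝ} (hs : 0 ≤ s)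
    (x : X) : MemLp ((Ici s).indicator fun t => 𝒰.U t s x) p halfLine := by
  obtain ⟨c, hc⟩ := h.exists_eLpNorm_orbit_le hp0 hp
  refine ⟨?_, (hc s x hs).trans_lt (ENNReal.mul_lt_top ENNReal.coe_lt_top enorm_lt_top)⟩
  rw [aestronglyMeasurable_indicator_iff measurableSet_Ici, halfLine_restrict hs]
  exact (𝒰.continuousOn_orbit hs x).aestronglyMeasurable measurableSet_Ici

/-- On `[s, T]`, the truncated orbit `w = 1_{[s,T]} W(·, s) x` satisfies
`w = U(·, s) x + 𝔾 D w`. -/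
theorem IsVolterraSolution.orbit_eq_add_green {D : StrongLinfty X X} (h : 𝒰.ExpBounded)
    (h𝒲 : 𝒰.IsVolterraSolution D.op 𝒲) (hp1 : 1 ≤ p) {s T t : ℝ} (hs : 0 ≤ s) (x : X)
    {f : ℝ → X} (hfp : MemLp f p halfLine)
    (hf : f =ᵐ[halfLine] fun τ => D.op τ ((Icc s T).indicator (fun t => 𝒲.U t s x) τ))
    (ht : t ∈ Icc s T) : 𝒲.U t s x = 𝒰.U t s x + 𝒰.green f t := by
  have ht0 : 0 ≤ t := hs.trans ht.1
  rw [h𝒲 s t hs ht.1 x, green_congr hf ht0, green]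
  have i := h.intervalIntegrable_of_memLp hp1 ((memLp_congr_ae hf).1 hfp) le_rfl ht0
  rw [← intervalIntegral.integral_add_adjacent_intervals (b := s)
    (i.mono_set (by rw [uIcc_of_le hs, uIcc_of_le ht0]; exact Icc_subset_Icc_right ht.1))
    (i.mono_set (by rw [uIcc_of_le ht.1, uIcc_of_le ht0]; exact Icc_subset_Icc_left hs))]
  -- The cutoff equals `1` at `τ = s`, so this endpoint is traded for `0` before the integrand is
  -- shown to vanish.
  have z : ∫ τ in (0 : ℝ)..s, 𝒰.U t τ
      (D.op τ ((Icc s T).indicator (fun t => 𝒲.U t s x) τ)) = 0 := by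
    rw [intervalIntegral.integral_of_le hs, ← integral_Ico_eq_integral_Ioc]
    refine setIntegral_eq_zero_of_forall_eq_zero fun τ hτ => ?_
    rw [indicator_of_notMem (fun hc => absurd hc.1 (not_le.2 hτ.2)), map_zero, map_zero]
  rw [z, zero_add]
  congr 1
  refine intervalIntegral.integral_congr fun τ hτ => ?_
  rw [uIcc_of_le ht.1] at hτ
  simp only [indicator_of_mem (show τ ∈ Icc s T from ⟨hτ.1, hτ.2.trans ht.2⟩)]

variable {V Y : Type*} [NormedAddCommGroup V] [NormedSpace ℂ V]
  [NormedAddCommGroup Y] [NormedSpace ℂ Y]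

/-- A perturbation `Δ` with `‖𝕃‖ ‖Δ‖_∞ < 1` preserves exponential stability. -/
theorem IsPerturbation.expStable [Fact (1 ≤ p)] (hp : p ≠ ∞) (h : 𝒰.ExpStable)
    {B : StrongLinfty V X} {C : StrongLinfty X Y} {Δ : StrongLinfty Y V} (hb : 𝒲.ExpBounded)
    (h𝒲 : 𝒰.IsPerturbation B C Δ 𝒲)
    (hsmall : ‖C.mulOp p ∘L 𝒰.greenOp h p hp ∘L B.mulOp p‖ * Δ.essNorm.toReal < 1) :
    𝒲.ExpStable := by
  have hp1 : 1 ≤ p := Fact.out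
  have hp0 : p ≠ 0 := (zero_lt_one.trans_le hp1).ne'
  obtain ⟨c₀, hc₀⟩ := h.exists_eLpNorm_orbit_le (p := p) hp0 hp
  set G := 𝒰.greenOp h p hp
  set L := C.mulOp p ∘L G ∘L B.mulOp p with hL
  set θ := ‖L‖ * Δ.essNorm.toReal
  have hθ : 0 < 1 - θ := by linarith
  set κ := ‖G‖ * ‖B.mulOp (p := p)‖ * ‖Δ.mulOp p‖
  have hκ : 0 ≤ κ := by positivity
  refine expStable_of_eLpNorm_le hb hp0 hp (c := c₀ + κ * (‖C.mulOp p‖ * c₀ / (1 - θ)))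
    (by positivity) fun s T x hs hsT => ?_
  have hwp := 𝒲.memLp_indicator_orbit (p := p) hs T x
  have hup := h.memLp_orbit (p := p) hp0 hp hs x
  set w : Lp X p halfLine := hwp.toLp _ with hw
  set u₀ : Lp X p halfLine := hup.toLp _ with hu₀
  set z := C.mulOp p w with hz
  set f := B.mulOp p (Δ.mulOp p z) with hf
  have hu₀n : ‖u₀‖ ≤ c₀ * ‖x‖ := by
    have := ENNReal.toReal_mono (ENNReal.mul_ne_top ENNReal.coe_ne_top enorm_ne_top)
      (hc₀ s x hs)
    rwa [ENNReal.toReal_mul, ENNReal.coe_toReal, toReal_enorm, ← Lp.norm_toLp _ hup] at this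
  have hfae : f =ᵐ[halfLine] fun τ => (B.comp (Δ.comp C)).op τ
      ((Icc s T).indicator (fun t => 𝒲.U t s x) τ) := by
    filter_upwards [B.coeFn_mulOp (Δ.mulOp p z), Δ.coeFn_mulOp z, C.coeFn_mulOp w,
      hwp.coeFn_toLp] with τ h1 h2 h3 h4
    rw [hf, h1, h2, hz, h3, hw, h4]
    rfl
  -- `u₀ + G f` is not cut off at `T`, but `w` agrees with it on `[s, T]` and is zero elsewhere, so
  -- norms compare in the useful direction.
  have hwae : ∀ᵐ t ∂halfLine, w t = (u₀ + G f) t ∨ w t = 0 := by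
    filter_upwards [hwp.coeFn_toLp, hup.coeFn_toLp, Lp.coeFn_add u₀ (G f),
      coeFn_greenOp h hp f] with t h1 h2 h3 h4
    by_cases ht : t ∈ Icc s T
    · left
      rw [h3, Pi.add_apply, hw, h1, hu₀, h2, h4, indicator_of_mem ht,
        indicator_of_mem (show t ∈ Ici s from ht.1)]
      exact IsVolterraSolution.orbit_eq_add_green (D := B.comp (Δ.comp C)) h.expBounded h𝒲 hp1 hs
        x (Lp.memLp f) hfae ht
    · right
      rw [hw, h1, indicator_of_notMem ht]
  have hwn : ‖w‖ ≤ ‖u₀ + G f‖ := by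
    refine Lp.norm_le_norm_of_ae_le ?_
    filter_upwards [hwae] with t ht
    rcases ht with ht | ht
    · rw [ht]
    · rw [ht, norm_zero]
      exact norm_nonneg _
  have hzn : ‖z‖ ≤ ‖C.mulOp p (u₀ + G f)‖ := by
    refine Lp.norm_le_norm_of_ae_le ?_
    filter_upwards [hwae, C.coeFn_mulOp w, C.coeFn_mulOp (u₀ + G f)] with t ht h1 h2
    rw [hz, h1, h2]
    rcases ht with ht | ht
    · rw [ht]
    · rw [ht, map_zero, norm_zero]
      exact norm_nonneg _
  -- Closing the feedback loop: `𝒞𝔾f = 𝕃Δz`, and `θ‖z‖` with `θ < 1` moves to the left side.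
  have hzθ : ‖z‖ ≤ ‖C.mulOp p‖ * (c₀ * ‖x‖) + θ * ‖z‖ := by
    refine hzn.trans ?_
    have e : C.mulOp p (G f) = L (Δ.mulOp p z) := rfl
    rw [map_add, e]
    refine (norm_add_le _ _).trans (add_le_add ?_ ?_)
    · exact (C.mulOp p).le_opNorm_of_le hu₀n
    · rw [mul_assoc]
      exact L.le_opNorm_of_le ((Δ.mulOp p).le_of_opNorm_le Δ.norm_mulOp_le z)
  have hzb : ‖z‖ ≤ ‖C.mulOp p‖ * c₀ / (1 - θ) * ‖x‖ := by
    rw [div_mul_eq_mul_div, le_div_iff₀ hθ]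
    linarith
  have hGf : ‖G f‖ ≤ κ * ‖z‖ := by
    rw [mul_assoc, mul_assoc]
    exact G.le_opNorm_of_le ((B.mulOp p).le_opNorm_of_le ((Δ.mulOp p).le_opNorm z))
  have fin : ‖w‖ ≤ (c₀ + κ * (‖C.mulOp p‖ * c₀ / (1 - θ))) * ‖x‖ := by
    calc ‖w‖ ≤ ‖u₀‖ + ‖G f‖ := hwn.trans (norm_add_le _ _)
      _ ≤ c₀ * ‖x‖ + κ * (‖C.mulOp p‖ * c₀ / (1 - θ) * ‖x‖) := by
          refine add_le_add hu₀n (hGf.trans ?_)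
          gcongr
      _ = _ := by ring
  rw [hw, Lp.norm_toLp] at fin
  rw [← ENNReal.ofReal_toReal hwp.2.ne]
  exact ENNReal.ofReal_le_ofReal fin

/-- Every `r < 1/‖𝕃‖` is admissible, by existence of `𝒰_Δ` and the small-gain estimate. Extended
nonnegative arithmetic includes `𝕃 = 0`. -/
theorem one_div_enorm_le_stabRadius [CompleteSpace X] [Fact (1 ≤ p)] (hp : p ≠ ∞) (h : 𝒰.ExpStable)
    (B : StrongLinfty V X) (C : StrongLinfty X Y) :
    1 / ‖C.mulOp p ∘L 𝒰.greenOp h p hp ∘L B.mulOp p‖ₑ ≤ 𝒰.stabRadius B C := by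
  set L := C.mulOp p ∘L 𝒰.greenOp h p hp ∘L B.mulOp p
  refine ENNReal.le_of_forall_nnreal_lt fun r hr => ?_
  refine le_iSup₂_of_le r (fun Δ hΔ => ?_) le_rfl
  obtain ⟨𝒲, hb, h𝒲⟩ := h.expBounded.exists_volterraSolution (B.comp (Δ.comp C))
  refine ⟨𝒲, h𝒲, IsPerturbation.expStable hp h hb h𝒲 ?_⟩
  have h1 : (r : ℝ≥0∞) * ‖L‖ₑ < 1 := ENNReal.mul_lt_of_lt_div hr
  have h2 := (ENNReal.toReal_lt_toReal h1.ne_top ENNReal.one_ne_top).2 h1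
  rw [ENNReal.toReal_mul, ENNReal.coe_toReal, toReal_enorm, ENNReal.toReal_one] at h2
  have h3 : Δ.essNorm.toReal ≤ r := by
    simpa using ENNReal.toReal_mono ENNReal.coe_ne_top hΔ
  calc ‖L‖ * Δ.essNorm.toReal ≤ ‖L‖ * r := by gcongr
    _ < 1 := by rwa [mul_comm]

end EvolutionFamily

/-! ### Generators of rescaled semigroups -/

section Generator

variable {E : Type*} [NormedAddCommGroup E] [NormedSpace ℂ E] {T S : ℝ → E →L[ℂ] E} {ν : ℂ}

/-- The product rule at `t = 0`: the factor `e^{νt}` adds `ν` to the generator. -/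
theorem tendsto_exp_smul_difference_quotient
    (h : ∀ t, 0 < t → ∀ x, S t x = Complex.exp (ν * t) • T t x) {x y : E}
    (hy : Tendsto (fun t : ℝ => t⁻¹ • (T t x - x)) (𝓝[>] 0) (𝓝 y)) :
    Tendsto (fun t : ℝ => t⁻¹ • (S t x - x)) (𝓝[>] 0) (𝓝 (y + ν • x)) := by
  have d : HasDerivAt (fun t : ℝ => Complex.exp (ν * t)) ν 0 := by
    have := ((hasDerivAt_id (0 : ℝ)).ofReal_comp.const_mul ν).cexp
    simpa using this
  have e0 : Tendsto (fun t : ℝ => Complex.exp (ν * t)) (𝓝[>] 0) (𝓝 1) := by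
    have := d.continuousAt.tendsto.mono_left (nhdsWithin_le_nhds (s := Ioi 0))
    simpa using this
  have e1 : Tendsto (fun t : ℝ => t⁻¹ • (Complex.exp (ν * t) - 1)) (𝓝[>] 0) (𝓝 ν) := by
    have := d.tendsto_slope_zero_right
    simpa using this
  have key := (e0.smul hy).add (e1.smul_const x)
  rw [one_smul] at key
  refine key.congr' ?_
  filter_upwards [self_mem_nhdsWithin] with t ht
  rw [h t ht, smul_comm, smul_assoc, ← smul_add]
  congr 1
  rw [smul_sub, sub_smul, one_smul]
  abel

/-- If `R = A⁻¹` and `Q = (A + ν)⁻¹`, then `(A + ν)Ry = y + νRy`, so `Q(y + νRy) = Ry`. Swapping the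
roles of `T` and `S` yields the other one-sided inverse. -/
theorem inverse_mul_of_exp_smul
    (h : ∀ t, 0 < t → ∀ x, S t x = Complex.exp (ν * t) • T t x) {R Q : E →L[ℂ] E}
    (hR : IsBoundedInverse (semigroupGenerator T) R)
    (hQ : IsBoundedInverse (semigroupGenerator S) Q) : (1 - ν • Q) * (1 + ν • R) = 1 := by
  have key : ∀ y, Q (y + ν • R y) = R y := by
    intro y
    obtain ⟨hy, e⟩ := hR.2 y
    have lim := semigroupGenerator_tendsto (T := T) ⟨R y, hy⟩
    rw [e] at lim
    obtain ⟨hx, e'⟩ := semigroupGenerator_eq_of_tendsto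
      (tendsto_exp_smul_difference_quotient h lim)
    rw [← e']
    exact hQ.1 ⟨R y, hx⟩
  ext y
  simp only [mul_apply_eq_comp, sub_apply, add_apply, smul_apply, one_apply_eq_self, key y]
  abel

/-- If the generators `A` and `A + ν` are both boundedly invertible, then `1 + ν A⁻¹` is
invertible. -/
theorem isUnit_one_add_smul_inverse
    (h : ∀ t, 0 < t → ∀ x, S t x = Complex.exp (ν * t) • T t x) {R Q : E →L[ℂ] E}
    (hR : IsBoundedInverse (semigroupGenerator T) R)
    (hQ : IsBoundedInverse (semigroupGenerator S) Q) : IsUnit (1 + ν • R) := by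
  have h' : ∀ t, 0 < t → ∀ x, T t x = Complex.exp (-ν * t) • S t x := by
    intro t ht x
    rw [h t ht, smul_smul, ← Complex.exp_add]
    simp
  have e1 := inverse_mul_of_exp_smul h hR hQ
  have e2 := inverse_mul_of_exp_smul h' hQ hR
  rw [neg_smul, neg_smul, sub_neg_eq_add, ← sub_eq_add_neg] at e2
  exact ⟨⟨_, _, e2, e1⟩, rfl⟩

end Generator

namespace StrongLinfty

/-- The constant function `t ↦ c • I`. -/
noncomputable def scalar (E : Type*) [NormedAddCommGroup E] [NormedSpace ℂ E] (c : ℂ) :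
    StrongLinfty E E where
  op := fun _ => c • ContinuousLinearMap.id ℂ E
  strongly_meas := fun _ => aestronglyMeasurable_const
  ess_bdd := lt_of_le_of_lt (essSup_le_of_ae_le ‖c • ContinuousLinearMap.id ℂ E‖ₑ
    (Eventually.of_forall fun _ => le_rfl)) enorm_lt_top

theorem essNorm_scalar_le (E : Type*) [NormedAddCommGroup E] [NormedSpace ℂ E] (c : ℂ) :
    (scalar E c).essNorm ≤ ‖c‖ₑ := by
  refine essSup_le_of_ae_le _ (Eventually.of_forall fun _ => ?_)
  change ‖c • ContinuousLinearMap.id ℂ E‖ₑ ≤ ‖c‖ₑ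
  rw [← ofReal_norm, ← ofReal_norm, norm_smul]
  exact ENNReal.ofReal_le_ofReal
    (mul_le_of_le_one_right (norm_nonneg _) ContinuousLinearMap.norm_id_le)

theorem mulOp_one (E : Type*) [NormedAddCommGroup E] [NormedSpace ℂ E] (p : ℝ≥0∞)
    [Fact (1 ≤ p)] : (one E).mulOp p = ContinuousLinearMap.id ℂ (Lp E p halfLine) := by
  ext1 f
  refine Lp.ext ?_
  filter_upwards [(one E).coeFn_mulOp f] with t ht
  rw [ht]
  rfl

end StrongLinfty

/-! ### Scalar perturbations and the upper bound for the stability radius -/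

namespace EvolutionFamily

variable {X : Type*} [NormedAddCommGroup X] [NormedSpace ℂ X] {𝒰 𝒲 𝒱 : EvolutionFamily X}
  {p : ℝ≥0∞}

theorem ExpBounded.intervalIntegrable_orbit (h : 𝒰.ExpBounded) (D : StrongLinfty X X)
    (𝒲 : EvolutionFamily X) {s t : ℝ} (hs : 0 ≤ s) (hst : s ≤ t) (x : X) :
    IntervalIntegrable (fun τ => 𝒰.U t τ (D.op τ (𝒲.U τ s x))) volume s t := by
  have c : Continuous fun τ => 𝒲.U (max τ s) s x :=
    (𝒲.continuousOn_orbit hs x).comp_continuous (by fun_prop) fun τ => le_max_right τ s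
  refine (h.intervalIntegrable_volterra D c hs hst le_rfl).congr fun τ hτ => ?_
  rw [uIoc_of_le hst] at hτ
  simp only [max_eq_left hτ.1.le]

/-- The difference solves the homogeneous equation and is exponentially bounded. `stabRadius`
supplies only some stable solution; this identifies it with an explicit one. -/
theorem IsVolterraSolution.eq (h : 𝒰.ExpBounded) {D : StrongLinfty X X}
    (h𝒲 : 𝒰.IsVolterraSolution D.op 𝒲) (h𝒱 : 𝒰.IsVolterraSolution D.op 𝒱)
    (hb𝒲 : 𝒲.ExpBounded) (hb𝒱 : 𝒱.ExpBounded) {s t : ℝ} (hs : 0 ≤ s) (hst : s ≤ t) :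
    𝒲.U t s = 𝒱.U t s := by
  obtain ⟨M₁, a₁, hM₁, hU₁⟩ := hb𝒲
  obtain ⟨M₂, a₂, hM₂, hU₂⟩ := hb𝒱
  ext x
  rw [← sub_eq_zero]
  refine eq_zero_of_volterra h ENNReal.toReal_nonneg D.ae_norm_op_le hs
    (v := fun t => 𝒲.U t s x - 𝒱.U t s x) (c := (M₁ + M₂) * ‖x‖) (a := max a₁ a₂)
    (fun t ht => ?_) (fun t ht => ?_) hst
  · have ht' : 0 ≤ t - s := sub_nonneg.2 ht
    calc ‖𝒲.U t s x - 𝒱.U t s x‖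
        ≤ M₁ * Real.exp (a₁ * (t - s)) * ‖x‖ + M₂ * Real.exp (a₂ * (t - s)) * ‖x‖ :=
          (norm_sub_le _ _).trans (add_le_add ((𝒲.U t s).le_of_opNorm_le (hU₁ s t hs ht) x)
            ((𝒱.U t s).le_of_opNorm_le (hU₂ s t hs ht) x))
      _ ≤ M₁ * Real.exp (max a₁ a₂ * (t - s)) * ‖x‖
          + M₂ * Real.exp (max a₁ a₂ * (t - s)) * ‖x‖ := by
          gcongr
          · exact le_max_left _ _
          · exact le_max_right _ _
      _ = _ := by ring
  · rw [h𝒲 s t hs ht x, h𝒱 s t hs ht x, add_sub_add_left_eq_sub,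
      ← intervalIntegral.integral_sub (h.intervalIntegrable_orbit D 𝒲 hs ht x)
        (h.intervalIntegrable_orbit D 𝒱 hs ht x)]
    simp only [map_sub]

theorem integral_mul_exp_sub (c : ℂ) (s t : ℝ) :
    ∫ τ in s..t, c * Complex.exp (c * (τ - s)) = Complex.exp (c * (t - s)) - 1 := by
  have d : ∀ τ : ℝ, HasDerivAt (fun τ : ℝ => Complex.exp (c * (τ - s)))
      (c * Complex.exp (c * (τ - s))) τ := by
    intro τ
    have := (((hasDerivAt_id τ).ofReal_comp.sub_const (s : ℂ)).const_mul c).cexp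
    simpa [mul_comm] using this
  rw [intervalIntegral.integral_eq_sub_of_hasDerivAt (fun τ _ => d τ)
    (Continuous.intervalIntegrable (by fun_prop) _ _)]
  simp

/-- For `D = cI` the cocycle law freezes the integrand to a scalar multiple of `U(t, s)x`, and the
scalar integrates to `e^{c(t-s)} - 1`. -/
theorem isVolterraSolution_rescale [CompleteSpace X] (𝒰 : EvolutionFamily X) (c : ℂ) :
    𝒰.IsVolterraSolution (StrongLinfty.scalar X c).op (𝒰.rescale c) := by
  intro s t hs hst x
  have e : ∫ τ in s..t, 𝒰.U t τ ((StrongLinfty.scalar X c).op τ ((𝒰.rescale c).U τ s x))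
      = ∫ τ in s..t, (c * Complex.exp (c * (τ - s))) • 𝒰.U t s x := by
    refine intervalIntegral.integral_congr fun τ hτ => ?_
    rw [uIcc_of_le hst] at hτ
    change 𝒰.U t τ (c • (𝒰.rescale c).U τ s x) = _
    simp only [rescale_apply, map_smul, smul_smul, 𝒰.comp s τ t hs hτ.1 hτ.2,
      ContinuousLinearMap.comp_apply]
  rw [e, intervalIntegral.integral_smul_const, integral_mul_exp_sub, sub_smul, one_smul,
    add_sub_cancel, rescale_apply]

/-- `E^t` propagates over elapsed time exactly `t`, so the rescaling factor is the constant
`e^{νt}`. -/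
theorem evolOp_rescale [Fact (1 ≤ p)] (ν : ℂ) (h : 𝒰.ExpBounded) (h' : (𝒰.rescale ν).ExpBounded)
    (t : ℝ) (f : Lp X p halfLine) :
    (𝒰.rescale ν).evolOp h' p t f = Complex.exp (ν * t) • 𝒰.evolOp h p t f := by
  refine Lp.ext ?_
  filter_upwards [coeFn_evolOp h' t f, Lp.coeFn_smul (Complex.exp (ν * t)) (𝒰.evolOp h p t f),
    coeFn_evolOp h t f] with τ h1 h2 h3
  rw [h1, h2, Pi.smul_apply, h3]
  unfold evolFun
  split_ifs
  · rw [rescale_apply]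
    congr 3
    push_cast
    ring
  · rw [smul_zero]

theorem expStable_rescale_of_norm_le {r : ℝ} (h : (𝒰.rescale (r : ℂ)).ExpStable)
    {ν : ℂ} (hν : ‖ν‖ ≤ r) : (𝒰.rescale ν).ExpStable := by
  obtain ⟨M, ω, hM, hω, hU⟩ := h
  refine ⟨M, ω, hM, hω, fun τ t h0 h1 => le_trans ?_ (hU τ t h0 h1)⟩
  rw [norm_rescale, norm_rescale, Complex.ofReal_re]
  have : 0 ≤ t - τ := sub_nonneg.2 h1
  gcongr
  exact (Complex.re_le_norm ν).trans hν

variable [CompleteSpace X] [Fact (1 ≤ p)] (hp : p ≠ ∞)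

theorem isUnit_one_sub_smul_greenOp (h : 𝒰.ExpStable) {ν : ℂ}
    (h' : (𝒰.rescale ν).ExpStable) : IsUnit (1 + ν • -𝒰.greenOp h p hp) :=
  isUnit_one_add_smul_inverse
    (fun t _ f => evolOp_rescale ν h.expBounded h'.expBounded t f)
    (isBoundedInverse_evolGenerator hp h) (isBoundedInverse_evolGenerator hp h')

/-- If `|k| > 1/r`, then `ν = -1/k` lies in the disc `|ν| ≤ r`, and `k - Γ⁻¹ = k(1 + νΓ⁻¹)` is
invertible because `Γ + ν` is. -/
theorem spectralRadius_greenOp_le (h : 𝒰.ExpStable) {r : ℝ≥0}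
    (hr : (𝒰.rescale (r : ℂ)).ExpStable) :
    spectralRadius ℂ (-𝒰.greenOp h p hp) ≤ (r : ℝ≥0∞)⁻¹ := by
  refine iSup₂_le fun k hk => ?_
  by_contra hlt
  rw [not_le, ENNReal.inv_lt_iff_inv_lt] at hlt
  have hk0 : k ≠ 0 := by
    rintro rfl
    simp at hlt
  have hkr : ‖(-k⁻¹ : ℂ)‖ ≤ r := by
    rw [← ENNReal.coe_inv (by simpa using hk0), ENNReal.coe_lt_coe] at hlt
    rw [norm_neg, norm_inv]
    exact_mod_cast hlt.le
  have hu := isUnit_one_sub_smul_greenOp (p := p) hp h (expStable_rescale_of_norm_le hr hkr)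
  refine hk ?_
  have e : algebraMap ℂ (Lp X p halfLine →L[ℂ] Lp X p halfLine) k - -𝒰.greenOp h p hp
      = k • (1 + (-k⁻¹) • -𝒰.greenOp h p hp) := by
    rw [Algebra.algebraMap_eq_smul_one, smul_add, smul_smul, mul_neg, mul_inv_cancel₀ hk0,
      neg_one_smul, sub_eq_add_neg]
  change IsUnit _
  rw [e]
  exact hu.smul (Units.mk0 k hk0)

theorem stabRadius_one_le (h : 𝒰.ExpStable) :
    𝒰.stabRadius (StrongLinfty.one X) (StrongLinfty.one X)
      ≤ 1 / spectralRadius ℂ (-𝒰.greenOp h p hp) := by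
  refine iSup₂_le fun r hr => ?_
  rw [one_div, ENNReal.le_inv_iff_le_inv]
  refine spectralRadius_greenOp_le hp h ?_
  -- The admissible radius is tested on `Δ = rI`, whose perturbed family must be the rescaling of
  -- `𝒰` by `r`.
  obtain ⟨𝒲, h𝒲, M, ω, hM, hω, hU⟩ := hr (StrongLinfty.scalar X (r : ℂ))
    ((StrongLinfty.essNorm_scalar_le X (r : ℂ)).trans (by
      rw [← ofReal_norm, Complex.norm_of_nonneg (NNReal.coe_nonneg r)]
      simp))
  refine ⟨M, ω, hM, hω, fun τ t h0 h1 => ?_⟩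
  rw [← IsVolterraSolution.eq (D := StrongLinfty.scalar X (r : ℂ)) h.expBounded h𝒲 (isVolterraSolution_rescale 𝒰 (r : ℂ))
    ⟨M, ω, hM, hU⟩ (h.expBounded.rescale _) h0 h1]
  exact hU τ t h0 h1

end EvolutionFamily

/-! ### Assembly of the theorem -/

theorem theorem3p2 {X V Y : Type*}
    [NormedAddCommGroup X] [NormedSpace ℂ X] [CompleteSpace X]
    [NormedAddCommGroup V] [NormedSpace ℂ V] [CompleteSpace V]
    [NormedAddCommGroup Y] [NormedSpace ℂ Y] [CompleteSpace Y]
    (p : ℝ≥0∞) [Fact (1 ≤ p)] (hp : p ≠ ∞)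
    (𝒰 : EvolutionFamily X) (h𝒰 : 𝒰.ExpStable)
    (B : StrongLinfty V X) (C : StrongLinfty X Y) :
    ∃ Γinv G : Lp X p halfLine →L[ℂ] Lp X p halfLine,
      -- `Γ` is invertible with bounded inverse `Γinv`, and `𝔾` acts boundedly on `L^p`
      IsBoundedInverse (𝒰.evolGenerator h𝒰.expBounded p) Γinv ∧
      (∀ f : Lp X p halfLine,
        (∀ t, 0 ≤ t → IntervalIntegrable (fun τ => 𝒰.U t τ (f τ)) volume 0 t) ∧
        G f =ᵐ[halfLine] 𝒰.green f) ∧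
      -- structured case
      (∃ L : Lp V p halfLine →L[ℂ] Lp Y p halfLine,
        (∀ u : Lp V p halfLine,
          (∀ t, 0 ≤ t → IntervalIntegrable (fun τ => 𝒰.U t τ (B.op τ (u τ))) volume 0 t) ∧
          L u =ᵐ[halfLine] 𝒰.inputOutput B C u) ∧
        L = C.mulOp p ∘L G ∘L B.mulOp p ∧
        L = -(C.mulOp p ∘L Γinv ∘L B.mulOp p) ∧
        1 / ‖L‖ₑ ≤ 𝒰.stabRadius B C) ∧
      -- unstructured case
      (∃ L : Lp X p halfLine →L[ℂ] Lp X p halfLine,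
        (∀ u : Lp X p halfLine,
          L u =ᵐ[halfLine] 𝒰.inputOutput (StrongLinfty.one X) (StrongLinfty.one X) u) ∧
        L = -Γinv ∧
        1 / ‖Γinv‖ₑ ≤ 𝒰.stabRadius (StrongLinfty.one X) (StrongLinfty.one X) ∧
        𝒰.stabRadius (StrongLinfty.one X) (StrongLinfty.one X) ≤ 1 / spectralRadius ℂ Γinv) := by
  have hp1 : 1 ≤ p := Fact.out
  set G := 𝒰.greenOp h𝒰 p hp
  have coe_inputOutput : ∀ u : Lp V p halfLine,
      (C.mulOp p ∘L G ∘L B.mulOp p) u =ᵐ[halfLine] 𝒰.inputOutput B C u := by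
    intro u
    filter_upwards [C.coeFn_mulOp (G (B.mulOp p u)),
      EvolutionFamily.coeFn_greenOp h𝒰 hp (B.mulOp p u),
      ae_restrict_mem measurableSet_Ici] with t h1 h2 ht
    rw [ContinuousLinearMap.comp_apply, ContinuousLinearMap.comp_apply, h1, h2,
      EvolutionFamily.green_congr (B.coeFn_mulOp u) ht]
    rfl
  refine ⟨-G, G, EvolutionFamily.isBoundedInverse_evolGenerator hp h𝒰, fun f =>
    ⟨fun t ht => h𝒰.expBounded.intervalIntegrable_of_memLp hp1 (Lp.memLp f) le_rfl ht,
      EvolutionFamily.coeFn_greenOp h𝒰 hp f⟩,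
    ⟨C.mulOp p ∘L G ∘L B.mulOp p, fun u =>
      ⟨fun t ht => h𝒰.expBounded.intervalIntegrable_of_memLp hp1 (B.memLp u) le_rfl ht,
        coe_inputOutput u⟩, rfl, ?_, EvolutionFamily.one_div_enorm_le_stabRadius hp h𝒰 B C⟩,
    ⟨G, fun u => EvolutionFamily.coeFn_greenOp h𝒰 hp u, (neg_neg G).symm, ?_,
      EvolutionFamily.stabRadius_one_le hp h𝒰⟩⟩
  · ext1 u
    simp only [ContinuousLinearMap.comp_apply, neg_apply, map_neg, neg_neg]
  · have := EvolutionFamily.one_div_enorm_le_stabRadius hp h𝒰 (StrongLinfty.one X)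
      (StrongLinfty.one X)
    rw [StrongLinfty.mulOp_one, ContinuousLinearMap.id_comp, ContinuousLinearMap.comp_id] at this
    rwa [enorm_neg]
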